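/- Let $X$ be a compact metric space. Assume one of the following two cases. (Endomorphism) $r\colon X\to X$ is continuous and finite-to-one. The branches at $x\in X$ are a finite enumeration $(\tau_i x)_{i\in I_x}$ of $r^{-1}(x)$ (normally without repetition; repetitions are allowed if inverse images are counted with multiplicity). (IFS) $\tau_1,\dots,\tau_N\colon X\to X$ are continuous. All of them are branches at every $x$, so $I_x=\{1,\dots,N\}$. In both cases $r^{-1}(x)$ denotes the family $(\tau_i x)_{i\in I_x}$. Put $r^{-0}(x)=\{x\}$, let $r^{-n-1}(x)$ be the union of the $r^{-1}(u)$, $u\in r^{-n}(x)$, and let $O^-(x)=\bigcup_{n\ge1}r^{-n}(x)$. Let $W\colon X\to[0,\infty)$ be Lipschitz, put $R_Wf(x)=\sum_{i\in I_x}W(\tau_ix)f(\tau_ix)$, and assume that $R_W1=1$ and that $R_Wf$ is continuous whenever $f$ is. Let $\Omega_x$ be the set of infinite paths from $x$: the sequences $(\omega_n)_{n\ge1}$ with $z_0=x$, $\omega_{n}\in I_{z_{n-1}}$, $z_{n}=\tau_{\omega_{n}}z_{n-1}$. Let $P_x$ be the probability measure on $\Omega_x$ that gives mass $W(z_1)\cdots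 W(z_n)$ to the cylinder of all paths with the given first $n$ steps $\omega_1,\dots,\omega_n$. A cycle is a finite set $C=\{x_0,\dots,x_{p-1}\}$ of $p\ge1$ distinct points with $x_{k+1}\in r^{-1}(x_k)$, indices modulo $p$. It is a $W$-cycle if $W=1$ on $C$. It is repelling if for each $y\in C$ there are $0<c<1$ and $\delta>0$ such that from every $x$ with $d(x,y)<\delta$ there starts a path with $d(z_{(n+1)p},y)\le c\,d(z_{np},y)$ for all $n\ge0$. For a $W$-cycle $C$ of length $p$ put $$\mathbf N_C(x)=\{(\omega_n)_n\in\Omega_x : \lim_{n\to\infty} z_{np}\text{ exists and lies in }C\},\qquad h_C(x)=P_x(\mathbf N_C(x)).$$ Assume that $W$ satisfies condition (TZ): (i) if $x$ is not on a cycle, then there is $n_x\ge0$ such that $r^{-n}(x)$ contains no zero of $W$ for all $n\ge n_x$; (ii) if $i\in I_x$ and $x\in r^{-m}(\tau_ix)$ for some $m\ge0$ (so $\tau_ix$ follows $x$ on a cycle), then for every $j\in I_x$, $j\ne i$, either $\tau_jx$ is not on a cycle or $W(\tau_jx)=0$. Assume further that some $W$-cycle meets the closure of $O^-(x)$ for every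 $x\in X$, that every $W$-cycle is repelling, and that for every Lipschitz $f\colon X\to\mathbb R$ the averages $\frac1n\sum_{k=0}^{n-1}R_W^kf$ converge uniformly on $X$ as $n\to\infty$. Then for every $x\in X$ the measure $P_x$ is supported on $\bigcup\{\mathbf N_C(x) : C\text{ a }W\text{-cycle}\}$, that is, $P_x$-almost every path lies in this union, and $$\sum_{C\ W\text{-cycle}}h_C(x)=1 .$$ -/

import Mathlib

open Filter Topology MeasureTheory ProbabilityTheory

noncomputable section

/-- A system of branches on `X` with labels in `I`.  From the point `x` one can move along the
finitely many branches `i ∈ branches x`, the branch `i` leading to the point `map i x`.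
These end points, counted once for every branch, are the elements of `r⁻¹(x)`. -/
structure BranchSystem (X I : Type*) where
  branches : X → Finset I
  map : I → X → X

/-- A position on a path: the current point, together with the label of the branch that led to it
(`none` at the starting point). -/
structure PathNode (X I : Type*) where
  point : X
  label : Option I

/-- Each level of the tree of paths is discrete; on sequences of nodes this gives the
σ-algebra generated by cylinders. -/
instance (X I : Type*) : MeasurableSpace (PathNode X I) := ⊤

namespace BranchSystem

variable {X I : Type*} (S : BranchSystem X I)

/-- The endomorphism case: the branches at `x` enumerate the inverse images of `x` under a
continuous map `r`.  The plain enumeration has `I = X`, `branches x = r⁻¹(x)`, `map y x = y`;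
other choices of labels allow inverse images to be counted with multiplicity. -/
def IsEndomorphismCase [TopologicalSpace X] : Prop :=
  ∃ r : X → X, Continuous r ∧ ∀ x y, (∃ i ∈ S.branches x, S.map i x = y) ↔ r y = x

/-- The case of an iterated function system: finitely many continuous maps `X → X`, all of which
may be applied at every point. -/
def IsIFSCase [TopologicalSpace X] : Prop :=
  Finite I ∧ (∀ x i, i ∈ S.branches x) ∧ ∀ i, Continuous (S.map i)

/-- The Ruelle operator `(R_W f)(x) = ∑_{y ∈ r⁻¹(x)} W(y) f(y)`. -/
def ruelle (W f : X → ℝ) : X → ℝ :=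
  fun x => ∑ i ∈ S.branches x, W (S.map i x) * f (S.map i x)

/-- The set `r⁻ⁿ(x)`. -/
def preimages : ℕ → X → Set X
  | 0, x => {x}
  | n + 1, x => {y | ∃ u ∈ preimages n x, ∃ i ∈ S.branches u, S.map i u = y}

/-- The backward orbit `O⁻(x) = ⋃_{n ≥ 1} r⁻ⁿ(x)`. -/
def backwardOrbit (x : X) : Set X := ⋃ n ≥ 1, S.preimages n x

/-- `x` is a point of some cycle. -/
def OnCycle (x : X) : Prop := ∃ n ≥ 1, x ∈ S.preimages n x

/-- `C` is a cycle: its points can be listed without repetition as `x₀, …, x_{p-1}`, `p = #C ≥ 1`,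
with `x_{k+1} ∈ r⁻¹(x_k)`, indices modulo `p`. -/
def IsCycle (C : Finset X) : Prop :=
  C.Nonempty ∧ ∃ x : ℕ → X, Set.range x = (C : Set X) ∧ (∀ k, x (k + C.card) = x k) ∧
    ∀ k, x (k + 1) ∈ S.preimages 1 (x k)

/-- A `W`-cycle: a cycle on which `W` is `1`. -/
def IsWCycle (W : X → ℝ) (C : Finset X) : Prop :=
  S.IsCycle C ∧ ∀ y ∈ C, W y = 1

/-- Transversality of the zeroes.  In the second clause `map i x` is the successor of `x` on a
cycle, and `map j x`, `j ≠ i`, are the other elements of `r⁻¹(x)`. -/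
structure TZ (W : X → ℝ) : Prop where
  eventually_ne_zero : ∀ x, ¬ S.OnCycle x →
    ∃ n₀ : ℕ, ∀ n ≥ n₀, ∀ y ∈ S.preimages n x, W y ≠ 0
  transversal : ∀ x, ∀ i ∈ S.branches x, (∃ m, x ∈ S.preimages m (S.map i x)) →
    ∀ j ∈ S.branches x, j ≠ i → ¬ S.OnCycle (S.map j x) ∨ W (S.map j x) = 0

/-- The set `Ω_x` of infinite paths `(z_n)` that start at `x`; here `z_0 = x`, and the node at time
`n` records `z_n` and the branch taken to reach it. -/
def paths (x : X) : Set (ℕ → PathNode X I) :=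
  {ω | ω 0 = ⟨x, none⟩ ∧ ∀ n, ∃ i ∈ S.branches (ω n).point,
    ω (n + 1) = ⟨S.map i (ω n).point, some i⟩}

/-- One step of the random walk: from `x` the branch `i` is taken with probability
`W (map i x)`. -/
def stepMeasure (W : X → ℝ) (x : X) : Measure (PathNode X I) :=
  ∑ i ∈ S.branches x, ENNReal.ofReal (W (S.map i x)) • Measure.dirac ⟨S.map i x, some i⟩

lemma isProbabilityMeasure_stepMeasure {W : X → ℝ} (h0 : ∀ x, 0 ≤ W x)
    (h1 : S.ruelle W 1 = 1) (x : X) : IsProbabilityMeasure (S.stepMeasure W x) := by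
  constructor
  have h := congrFun h1 x
  simp only [ruelle, Pi.one_apply, mul_one] at h
  simp only [stepMeasure, Measure.coe_finsetSum, Finset.sum_apply, Measure.smul_apply,
    measure_univ, smul_eq_mul, mul_one]
  rw [← ENNReal.ofReal_sum_of_nonneg fun i _ => h0 _, h, ENNReal.ofReal_one]

/-- The transition kernel at time `n`: given the nodes up to time `n`, make one step from the
current point. -/
def stepKernel (W : X → ℝ) (n : ℕ) :
    Kernel ((k : Finset.Iic n) → PathNode X I) (PathNode X I) where
  toFun h := S.stepMeasure W (h ⟨n, Finset.mem_Iic.2 le_rfl⟩).point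
  measurable' :=
    (measurable_from_top (f := fun a : PathNode X I => S.stepMeasure W a.point)).comp
      (measurable_pi_apply _)

/-- The path measure `P_x`: the law of the random walk that starts at `x`. -/
def pathMeasure (W : X → ℝ) (h0 : ∀ x, 0 ≤ W x) (h1 : S.ruelle W 1 = 1) (x : X) :
    Measure (ℕ → PathNode X I) :=
  haveI : ∀ n, IsMarkovKernel (S.stepKernel W n) :=
    fun _ => ⟨fun _ => S.isProbabilityMeasure_stepMeasure h0 h1 _⟩
  Kernel.traj (X := fun _ => PathNode X I) (S.stepKernel W) 0 (fun _ => ⟨x, none⟩)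

/-- The set `N_C(x)` of the paths from `x` for which `z_{np}`, `p = #C`, converges to a point
of `C`. -/
def cycleSet (C : Finset X) (x : X) [TopologicalSpace X] : Set (ℕ → PathNode X I) :=
  {ω ∈ S.paths x | ∃ y ∈ C, Tendsto (fun n => (ω (n * C.card)).point) atTop (𝓝 y)}

/-- The function `h_C(x) = P_x(N_C(x))`. -/
def cycleFun (W : X → ℝ) (h0 : ∀ x, 0 ≤ W x) (h1 : S.ruelle W 1 = 1)
    [TopologicalSpace X] (C : Finset X) (x : X) : ℝ :=
  (S.pathMeasure W h0 h1 x).real (S.cycleSet C x)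

/-- A cycle of length `p` is repelling if each of its points `y` is a repelling fixed point for the
`p`-th iterate: there are `0 < c < 1` and `δ > 0` such that from each `x` at distance less than `δ`
from `y` there is a path, observed at the multiples of `p`, which approaches `y` at the
geometric rate `c`.  The starting point `z_0 = x` is included. -/
def IsRepelling [MetricSpace X] (C : Finset X) : Prop :=
  ∀ y ∈ C, ∃ c δ : ℝ, 0 < c ∧ c < 1 ∧ 0 < δ ∧ ∀ x, dist x y < δ → ∃ ω ∈ S.paths x,
    ∀ n : ℕ, dist (ω ((n + 1) * C.card)).point y ≤ c * dist (ω (n * C.card)).point y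

end BranchSystem

end

/-! Let `φ x` be the sum of the masses of the single paths from `x` that are asymptotic to the
`S.next W`-orbit of a point of some `W`-cycle (`asymptoticMass`). Since `φ ≤ 1`, the point is to
show `1 ≤ φ`. Then `P_x` lives on countably many such paths, each of which lies in a `cycleSet`, and
these sets are disjoint.

Prefixing a step keeps a path asymptotic, so `φ` is superharmonic: `R_W φ ≤ φ`
(`sum_mul_asymptoticMass_le`). From a point near a repelling `W`-cycle one path approaches the cycle
geometrically. As `W` is Lipschitz and equals `1` on the cycle, the weights along this path have
product at least `1 - η` (`IsWCycle.exists_path_of_near`). Hence `(1 - η) f ≤ φ` for a Lipschitz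
bump `f` around the cycles, and `(1 - η) R_W^k f ≤ φ` for all `k`. One bump serves all cycles
because they have finitely many points (`finite_wCyclePoints`).

The Cesàro averages of `R_W^k f` tend to a continuous harmonic function equal to `1` on every
`W`-cycle. By (TZ) and the hypothesis on backward orbits it satisfies a minimum principle
(`one_le_of_harmonic`), so it is at least `1`. Therefore `φ ≥ 1 - η` for every `η > 0`. No
regularity of `φ` is needed. -/

namespace BranchSystem

/-! ### Walks, weights and transversality. -/

section Basic

variable {X I : Type*} (S : BranchSystem X I)

/-- `y` is one of the elements of `r⁻¹(x)`. -/
def Step (x y : X) : Prop := ∃ i ∈ S.branches x, S.map i x = y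

lemma mem_preimages_succ {n : ℕ} {x y : X} :
    y ∈ S.preimages (n + 1) x ↔ ∃ u ∈ S.preimages n x, S.Step u y := Iff.rfl

lemma mem_preimages_one {x y : X} : y ∈ S.preimages 1 x ↔ S.Step x y := by
  rw [mem_preimages_succ]
  simp [preimages]

lemma mem_preimages_add {m n : ℕ} {x y z : X} (hy : y ∈ S.preimages m x)
    (hz : z ∈ S.preimages n y) : z ∈ S.preimages (m + n) x := by
  induction n generalizing z with
  | zero =>
    rw [preimages, Set.mem_singleton_iff] at hz
    rwa [hz]
  | succ n ih =>
    obtain ⟨u, hu, huz⟩ := hz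
    exact ⟨u, ih hu, huz⟩

lemma mem_preimages_of_walk {v : ℕ → X} {p : ℕ} (hv : ∀ k < p, S.Step (v k) (v (k + 1)))
    {m n : ℕ} (hmn : m ≤ n) (hn : n ≤ p) : v n ∈ S.preimages (n - m) (v m) := by
  induction n, hmn using Nat.le_induction with
  | base => simp [preimages]
  | succ n hmn ih =>
    rw [Nat.succ_sub hmn]
    exact ⟨v n, ih (by omega), hv n (by omega)⟩

lemma exists_walk_of_mem_preimages {n : ℕ} {x y : X} (h : y ∈ S.preimages n x) :
    ∃ v : ℕ → X, v 0 = x ∧ v n = y ∧ ∀ k < n, S.Step (v k) (v (k + 1)) := by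
  induction n generalizing y with
  | zero => exact ⟨fun _ => x, rfl, by simpa [preimages, eq_comm] using h, by simp⟩
  | succ n ih =>
    obtain ⟨u, hu, huy⟩ := h
    obtain ⟨v, h0, hn, hv⟩ := ih hu
    refine ⟨fun k => if k ≤ n then v k else y, by simpa using h0, by simp, fun k hk => ?_⟩
    rcases Nat.lt_succ_iff_lt_or_eq.1 hk with hk | rfl
    · simpa [hk.le, Nat.succ_le_of_lt hk] using hv k hk
    · simpa [hn] using (show S.Step u y from huy)

lemma step_of_mem_paths {x : X} {ω : ℕ → PathNode X I} (h : ω ∈ S.paths x) (n : ℕ) :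
    S.Step (ω n).point (ω (n + 1)).point := by
  obtain ⟨i, hi, e⟩ := h.2 n
  exact ⟨i, hi, by rw [e]⟩

lemma point_zero_of_mem_paths {x : X} {ω : ℕ → PathNode X I} (h : ω ∈ S.paths x) :
    (ω 0).point = x := by rw [h.1]

open Classical in
/-- The element of `r⁻¹(x)` of weight one, if there is one. -/
noncomputable def next (W : X → ℝ) (x : X) : X :=
  if h : ∃ y, S.Step x y ∧ W y = 1 then h.choose else x

variable {S} {W : X → ℝ}

lemma sum_weight (hW1 : S.ruelle W 1 = 1) (x : X) :
    ∑ i ∈ S.branches x, W (S.map i x) = 1 := by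
  simpa [ruelle] using congrFun hW1 x

lemma weight_le_one (hW0 : ∀ x, 0 ≤ W x) (hW1 : S.ruelle W 1 = 1) {x y : X}
    (h : S.Step x y) : W y ≤ 1 := by
  obtain ⟨i, hi, rfl⟩ := h
  rw [← sum_weight hW1 x]
  exact Finset.single_le_sum (f := fun i => W (S.map i x)) (fun _ _ => hW0 _) hi

lemma weight_add_weight_le_one (hW0 : ∀ x, 0 ≤ W x) (hW1 : S.ruelle W 1 = 1) {x : X} {i j : I}
    (hi : i ∈ S.branches x) (hj : j ∈ S.branches x) (hij : i ≠ j) :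
    W (S.map i x) + W (S.map j x) ≤ 1 := by
  classical
  rw [← sum_weight hW1 x, ← Finset.sum_pair (f := fun i => W (S.map i x)) hij]
  exact Finset.sum_le_sum_of_subset_of_nonneg (by simp [Finset.insert_subset_iff, hi, hj])
    fun _ _ _ => hW0 _

lemma step_unique (hW0 : ∀ x, 0 ≤ W x) (hW1 : S.ruelle W 1 = 1) {x y z : X}
    (hy : S.Step x y) (hz : S.Step x z) (h : 1 < W y + W z) : y = z := by
  obtain ⟨i, hi, rfl⟩ := hy
  obtain ⟨j, hj, rfl⟩ := hz
  by_contra hne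
  exact absurd (weight_add_weight_le_one hW0 hW1 hi hj (by rintro rfl; exact hne rfl)) (by linarith)

lemma exists_step_pos (hW0 : ∀ x, 0 ≤ W x) (hW1 : S.ruelle W 1 = 1) (x : X) :
    ∃ y, S.Step x y ∧ 0 < W y := by
  by_contra! h
  have := sum_weight hW1 x
  rw [Finset.sum_eq_zero fun i hi => le_antisymm (h _ ⟨i, hi, rfl⟩) (hW0 _)] at this
  simp at this

lemma next_spec {x y : X} (hy : S.Step x y) (h1 : W y = 1) :
    S.Step x (S.next W x) ∧ W (S.next W x) = 1 := by
  have h : ∃ y, S.Step x y ∧ W y = 1 := ⟨y, hy, h1⟩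
  rw [next, dif_pos h]
  exact h.choose_spec

lemma eq_next (hW0 : ∀ x, 0 ≤ W x) (hW1 : S.ruelle W 1 = 1) {x y z : X}
    (hy : S.Step x y) (h1 : W y = 1) (hz : S.Step x z) (hne : W z ≠ 0) : z = S.next W x := by
  obtain ⟨h2, h3⟩ := next_spec hy h1
  refine step_unique hW0 hW1 hz h2 ?_
  have := (hW0 z).lt_of_ne' hne
  linarith

lemma ruelle_apply_eq_next (hW0 : ∀ x, 0 ≤ W x) (hW1 : S.ruelle W 1 = 1) {x y : X}
    (hy : S.Step x y) (h1 : W y = 1) (f : X → ℝ) : S.ruelle W f x = f (S.next W x) := by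
  have h : ∀ i ∈ S.branches x, W (S.map i x) * f (S.map i x)
      = W (S.map i x) * f (S.next W x) := by
    intro i hi
    rcases eq_or_ne (W (S.map i x)) 0 with h0 | h0
    · simp [h0]
    · rw [eq_next hW0 hW1 hy h1 ⟨i, hi, rfl⟩ h0]
  rw [ruelle, Finset.sum_congr rfl h, ← Finset.sum_mul, sum_weight hW1, one_mul]

/-- Two steps of weight above `1 / 2` from one point cannot end at different points. This identifies
shadowing paths that are obtained independently. -/
lemma walk_unique (hW0 : ∀ x, 0 ≤ W x) (hW1 : S.ruelle W 1 = 1) {u v : ℕ → X}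
    (h0 : u 0 = v 0) (hu : ∀ n, S.Step (u n) (u (n + 1))) (hv : ∀ n, S.Step (v n) (v (n + 1)))
    (hWu : ∀ n, 1 / 2 < W (u (n + 1))) (hWv : ∀ n, 1 / 2 < W (v (n + 1))) (n : ℕ) :
    u n = v n := by
  induction n with
  | zero => exact h0
  | succ n ih =>
    refine step_unique hW0 hW1 (hu n) (ih ▸ hv n) ?_
    linarith [hWu n, hWv n]

/-- A closed walk through points of cycles is determined by the transversality of the zeroes. -/
lemma TZ.closed_walk_eq (hTZ : S.TZ W) {v t : ℕ → X} {p : ℕ}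
    (hv : ∀ k < p, S.Step (v k) (v (k + 1))) (hclosed : v p = v 0) (h0 : t 0 = v 0)
    (ht : ∀ k, S.Step (t k) (t (k + 1))) (hWt : ∀ k, W (t (k + 1)) ≠ 0)
    (hon : ∀ k, S.OnCycle (t k)) {k : ℕ} (hk : k ≤ p) : v k = t k := by
  induction k with
  | zero => exact h0.symm
  | succ k ih =>
    have ih := ih (by omega)
    obtain ⟨i, hi, ei⟩ := hv k (by omega)
    obtain ⟨j, hj, ej⟩ := ht k
    rw [← ih] at hj ej
    -- Different branches at a common point would both end on cycles: that of `v` because `v` closes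
    -- up, that of `t` by `hon`, with nonzero weight. Transversality excludes this.
    by_cases hij : j = i
    · rw [← ei, ← ej, hij]
    · exfalso
      have h1 : v k ∈ S.preimages (p - (k + 1) + k) (v (k + 1)) := by
        refine S.mem_preimages_add (S.mem_preimages_of_walk hv hk le_rfl) ?_
        rw [hclosed]
        simpa using S.mem_preimages_of_walk hv (Nat.zero_le k) (by omega)
      rcases hTZ.transversal (v k) i hi ⟨_, by rw [ei]; exact h1⟩ j hj hij with h | h
      · exact h (ej ▸ hon (k + 1))
      · exact hWt k (ej ▸ h)

end Basic

/-! ### `W`-cycles as periodic orbits of `next`. -/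

section Cycles

variable {X I : Type*} {S : BranchSystem X I} {W : X → ℝ} {C D : Finset X} {x y : X}

lemma IsWCycle.step_next (hC : S.IsWCycle W C) (hy : y ∈ C) :
    S.Step y (S.next W y) ∧ W (S.next W y) = 1 := by
  obtain ⟨⟨-, x, hx, -, hs⟩, h1⟩ := hC
  obtain ⟨k, rfl⟩ : y ∈ Set.range x := by rw [hx]; exact hy
  refine next_spec ((S.mem_preimages_one).1 (hs k)) (h1 _ ?_)
  rw [← Finset.mem_coe, ← hx]
  exact Set.mem_range_self _

lemma IsWCycle.exists_orbit (hW0 : ∀ x, 0 ≤ W x) (hW1 : S.ruelle W 1 = 1)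
    (hC : S.IsWCycle W C) (hy : y ∈ C) :
    (C : Set X) = Set.range (fun k => (S.next W)^[k] y) ∧ (S.next W)^[C.card] y = y := by
  have hC' := hC
  obtain ⟨⟨hne, x, hx, hper, hs⟩, h1⟩ := hC
  have hxC : ∀ k, x k ∈ C := fun k => by rw [← Finset.mem_coe, ← hx]; exact Set.mem_range_self _
  have hnext : ∀ k, x (k + 1) = S.next W (x k) := fun k => by
    have h := (S.mem_preimages_one).1 (hs k)
    exact eq_next hW0 hW1 h (h1 _ (hxC _)) h (by simp [h1 _ (hxC _)])
  have hit : ∀ k l, x (k + l) = (S.next W)^[l] (x k) := fun k l => by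
    induction l with
    | zero => rfl
    | succ l ih => rw [Function.iterate_succ_apply', ← ih, ← hnext]; rfl
  obtain ⟨k, rfl⟩ : y ∈ Set.range x := by rw [hx]; exact hy
  refine ⟨?_, by rw [← hit, hper]⟩
  rw [← hx]
  ext z
  constructor
  · rintro ⟨l, rfl⟩
    have hmul : ∀ m, x (l + m * C.card) = x l := fun m => by
      induction m with
      | zero => simp
      | succ m ih => rw [Nat.succ_mul, ← add_assoc, hper, ih]
    -- Adding `k` full turns to `l` makes the subtraction of `k` in `ℕ` harmless.
    have hle : k ≤ l + k * C.card := by nlinarith [hne.card_pos]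
    refine ⟨l + k * C.card - k, ?_⟩
    rw [← hmul k]
    simp only
    rw [← hit, Nat.add_sub_cancel' hle]
  · rintro ⟨l, rfl⟩
    exact ⟨k + l, hit k l⟩

lemma IsWCycle.iterate_mem (hW0 : ∀ x, 0 ≤ W x) (hW1 : S.ruelle W 1 = 1)
    (hC : S.IsWCycle W C) (hy : y ∈ C) (k : ℕ) : (S.next W)^[k] y ∈ C := by
  rw [← Finset.mem_coe, (hC.exists_orbit hW0 hW1 hy).1]
  exact Set.mem_range_self _

lemma IsWCycle.iterate_mul_add (hW0 : ∀ x, 0 ≤ W x) (hW1 : S.ruelle W 1 = 1)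
    (hC : S.IsWCycle W C) (hy : y ∈ C) (n k : ℕ) :
    (S.next W)^[n * C.card + k] y = (S.next W)^[k] y := by
  have h : Function.IsPeriodicPt (S.next W) C.card y := (hC.exists_orbit hW0 hW1 hy).2
  rw [Nat.add_comm, Function.iterate_add_apply, (h.const_mul n).eq]

lemma IsWCycle.eq_of_mem (hW0 : ∀ x, 0 ≤ W x) (hW1 : S.ruelle W 1 = 1)
    (hC : S.IsWCycle W C) (hD : S.IsWCycle W D) (hy : y ∈ C) (hy' : y ∈ D) : C = D := by
  rw [← Finset.coe_inj, (hC.exists_orbit hW0 hW1 hy).1, (hD.exists_orbit hW0 hW1 hy').1]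

lemma IsWCycle.onCycle (hW0 : ∀ x, 0 ≤ W x) (hW1 : S.ruelle W 1 = 1)
    (hC : S.IsWCycle W C) (hy : y ∈ C) : S.OnCycle y := by
  refine ⟨C.card, hC.1.1.card_pos, ?_⟩
  have h := S.mem_preimages_of_walk (v := fun k => (S.next W)^[k] y) (p := C.card)
    (fun k _ => by
      rw [Function.iterate_succ_apply']
      exact (hC.step_next (hC.iterate_mem hW0 hW1 hy k)).1) (Nat.zero_le _) le_rfl
  simpa [(hC.exists_orbit hW0 hW1 hy).2] using h

/-- Some closed walk passes through `x`, and transversality forces it to follow the orbit of `next`,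
which is therefore periodic. The minimal period lists the cycle without repetition. -/
lemma exists_isWCycle_of_onCycle (hTZ : S.TZ W)
    (hstep : ∀ k, S.Step ((S.next W)^[k] x) ((S.next W)^[k + 1] x))
    (hone : ∀ k, W ((S.next W)^[k + 1] x) = 1) (hon : ∀ k, S.OnCycle ((S.next W)^[k] x)) :
    ∃ C, S.IsWCycle W C ∧ x ∈ C := by
  classical
  obtain ⟨p, hp, hxp⟩ := hon 0
  obtain ⟨v, hv0, hvp, hv⟩ := S.exists_walk_of_mem_preimages hxp
  simp only [Function.iterate_zero, id] at hv0 hvp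
  have hper : Function.IsPeriodicPt (S.next W) p x := by
    have h := hTZ.closed_walk_eq (t := fun k => (S.next W)^[k] x) hv (by rw [hvp, hv0])
      (by rw [hv0]; rfl) hstep (fun k => by rw [hone]; exact one_ne_zero) hon le_rfl
    rw [hvp] at h
    exact h.symm
  set q := Function.minimalPeriod (S.next W) x with hq
  have hq0 : 0 < q := hper.minimalPeriod_pos hp
  set C : Finset X := (Finset.range q).image fun k => (S.next W)^[k] x with hC
  have hcard : C.card = q := by
    rw [hC, Finset.card_image_of_injOn, Finset.card_range]
    intro a ha b hb hab
    exact Function.iterate_injOn_Iio_minimalPeriod (by simpa using ha) (by simpa using hb) hab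
  have hrange : Set.range (fun k => (S.next W)^[k] x) = (C : Set X) := by
    ext z
    simp only [hC, Set.mem_range, Finset.coe_image, Set.mem_image, Finset.coe_range, Set.mem_Iio]
    constructor
    · rintro ⟨k, rfl⟩
      exact ⟨k % q, Nat.mod_lt _ hq0, Function.iterate_mod_minimalPeriod_eq⟩
    · rintro ⟨k, -, rfl⟩
      exact ⟨k, rfl⟩
  have hxC : ∀ k, (S.next W)^[k] x ∈ C := fun k => by
    rw [← Finset.mem_coe, ← hrange]
    exact Set.mem_range_self k
  refine ⟨C, ⟨⟨⟨x, hxC 0⟩, fun k => (S.next W)^[k] x, hrange, fun k => ?_, fun k => ?_⟩, ?_⟩, hxC 0⟩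
  · rw [hcard]
    exact Function.iterate_add_minimalPeriod_eq
  · exact (S.mem_preimages_one).2 (hstep k)
  · intro y hy
    rw [← Finset.mem_coe, ← hrange] at hy
    obtain ⟨k, rfl⟩ := hy
    -- `hone` covers only positive iterates, so one full period is added to `k`.
    have h := hone (k + (q - 1))
    rwa [show k + (q - 1) + 1 = k + q by omega, Function.iterate_add_minimalPeriod_eq] at h

end Cycles

/-! ### Compactness, and the dynamics near repelling `W`-cycles. -/

section Topology

variable {X I : Type*} {S : BranchSystem X I} {W : X → ℝ}

/-- The relation `y ∈ r⁻¹(x)` is closed. -/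
lemma step_of_tendsto [TopologicalSpace X] [T2Space X] (hS : S.IsEndomorphismCase ∨ S.IsIFSCase)
    {α : Type*} {𝒰 : Ultrafilter α} {u v : α → X} {x y : X} (h : ∀ᶠ a in 𝒰, S.Step (u a) (v a))
    (hu : Tendsto u 𝒰 (𝓝 x)) (hv : Tendsto v 𝒰 (𝓝 y)) : S.Step x y := by
  rcases hS with ⟨r, hr, hSr⟩ | ⟨hfin, hall, hcont⟩
  · refine (hSr x y).2 (tendsto_nhds_unique ((hr.tendsto y).comp hv) (hu.congr' ?_))
    filter_upwards [h] with a ha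
    exact ((hSr _ _).1 ha).symm
  -- Among finitely many maps the ultrafilter selects a single one.
  · obtain ⟨i, hi⟩ := Ultrafilter.eventually_exists_iff.1 (h.mono fun a ha => ha.imp fun i hi => hi.2)
    exact ⟨i, hall x i, tendsto_nhds_unique (((hcont i).tendsto x).comp hu) (hv.congr' <| by
      filter_upwards [hi] with a ha
      exact ha.symm)⟩

/-- A positive radius that is good for each of finitely many points. -/
lemma exists_uniform_radius {P : X → ℝ → Prop} (hP : ∀ y δ δ', δ' ≤ δ → P y δ → P y δ')
    (C : Finset X) (h : ∀ y ∈ C, ∃ δ > 0, P y δ) : ∃ δ > 0, ∀ y ∈ C, P y δ := by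
  classical
  induction C using Finset.induction_on with
  | empty => exact ⟨1, one_pos, by simp⟩
  | insert a C ha ih =>
    obtain ⟨δ, hδ, h1⟩ := ih fun y hy => h y (Finset.mem_insert_of_mem hy)
    obtain ⟨δ', hδ', h2⟩ := h a (Finset.mem_insert_self _ _)
    refine ⟨min δ δ', lt_min hδ hδ', fun y hy => ?_⟩
    rcases Finset.mem_insert.1 hy with rfl | hy
    · exact hP _ _ _ (min_le_right _ _) h2
    · exact hP _ _ _ (min_le_left _ _) (h1 y hy)

variable [MetricSpace X] {C D : Finset X} {y : X}

/-- One number `δ` serves both as radius and as the gap `1 - c`, so that the condition is inherited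
by smaller `δ`. The minimum with `1 / 2` keeps the rate positive. -/
lemma IsRepelling.exists_uniform (h : S.IsRepelling C) : ∃ c δ : ℝ, 0 < c ∧ c < 1 ∧ 0 < δ ∧
    ∀ y ∈ C, ∀ x, dist x y < δ → ∃ ω ∈ S.paths x,
      ∀ n : ℕ, dist (ω ((n + 1) * C.card)).point y ≤ c * dist (ω (n * C.card)).point y := by
  obtain ⟨δ, hδ, hP⟩ := exists_uniform_radius (C := C) (P := fun y δ => ∀ x, dist x y < δ →
    ∃ ω ∈ S.paths x, ∀ n : ℕ, dist (ω ((n + 1) * C.card)).point y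
      ≤ (1 - δ) * dist (ω (n * C.card)).point y)
    (fun y δ δ' hle hP x hx => (hP x (hx.trans_le hle)).imp fun ω hω => ⟨hω.1, fun n =>
      (hω.2 n).trans (mul_le_mul_of_nonneg_right (by linarith) dist_nonneg)⟩)
    (fun y hy => by
      obtain ⟨c, δ, hc0, hc1, hδ, hP⟩ := h y hy
      refine ⟨min (1 - c) δ, lt_min (by linarith) hδ, fun x hx => ?_⟩
      exact (hP x (hx.trans_le (min_le_right _ _))).imp fun ω hω => ⟨hω.1, fun n =>
        (hω.2 n).trans (mul_le_mul_of_nonneg_right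
          (by linarith [min_le_left (1 - c) δ]) dist_nonneg)⟩)
  refine ⟨1 - min δ (1 / 2), min δ (1 / 2), ?_, ?_, lt_min hδ (by norm_num), fun y hy x hx => ?_⟩
  · linarith [min_le_right δ (1 / 2)]
  · linarith [lt_min hδ (by norm_num : (0 : ℝ) < 1 / 2)]
  · exact (hP y hy x (hx.trans_le (min_le_left _ _))).imp fun ω hω => ⟨hω.1, fun n =>
      (hω.2 n).trans (mul_le_mul_of_nonneg_right
        (by linarith [min_le_left δ (1 / 2)]) dist_nonneg)⟩

variable [CompactSpace X]

/-- Paths that nearly close up at a point of a `W`-cycle stay close to that cycle. -/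
lemma IsWCycle.exists_closing_radius (hS : S.IsEndomorphismCase ∨ S.IsIFSCase)
    (hW0 : ∀ x, 0 ≤ W x) (hW1 : S.ruelle W 1 = 1) (hTZ : S.TZ W) (hC : S.IsWCycle W C)
    (hy : y ∈ C) (p : ℕ) {ε : ℝ} (hε : 0 < ε) :
    ∃ δ > 0, ∀ w : ℕ → X, (∀ k < p, S.Step (w k) (w (k + 1))) → dist (w 0) y < δ →
      dist (w p) y < δ → ∀ k ≤ p, dist (w k) ((S.next W)^[k] y) < ε := by
  -- Walks of fixed length `p` whose two ends tend to `y` have a closed walk at `y` as ultrafilter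
  -- limit. By `TZ.closed_walk_eq` this is the orbit of `y`, against the distance `ε` kept at some
  -- fixed time.
  by_contra! hcon
  choose w hw h0 hp k hk hd using fun n : ℕ => hcon (1 / ((n : ℝ) + 1)) Nat.one_div_pos_of_nat
  set 𝒰 := hyperfilter ℕ
  have hle : (𝒰 : Filter ℕ) ≤ atTop := Nat.hyperfilter_le_atTop
  have hlim : ∀ k, ∃ v, Tendsto (fun n => w n k) 𝒰 (𝓝 v) := fun k =>
    ⟨(𝒰.map fun n => w n k).lim, (𝒰.map fun n => w n k).le_nhds_lim⟩
  choose v hv using hlim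
  have hend : ∀ k, (∀ n, dist (w n k) y < 1 / ((n : ℝ) + 1)) → v k = y := by
    intro k hk
    refine tendsto_nhds_unique (hv k) (tendsto_iff_dist_tendsto_zero.2 ?_)
    exact squeeze_zero (fun _ => dist_nonneg) (fun n => (hk n).le)
      (tendsto_one_div_add_atTop_nhds_zero_nat.mono_left hle)
  have hv0 := hend 0 h0
  have hvp := hend p hp
  have hmem := hC.iterate_mem hW0 hW1 hy
  obtain ⟨l, hl, hld⟩ := (Ultrafilter.eventually_exists_mem_iff (f := 𝒰) (Set.finite_Iic p)
    (P := fun l n => ε ≤ dist (w n l) ((S.next W)^[l] y))).1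
    (Eventually.of_forall fun n => ⟨k n, hk n, hd n⟩)
  have heq : v l = (S.next W)^[l] y :=
    hTZ.closed_walk_eq (p := p)
      (fun k hk => step_of_tendsto hS (Eventually.of_forall fun n => hw n k hk) (hv k) (hv (k + 1)))
      (by rw [hvp, hv0]) (by simp [hv0]) (t := fun k => (S.next W)^[k] y)
      (fun k => by rw [Function.iterate_succ_apply']; exact (hC.step_next (hmem k)).1)
      (fun k => by rw [hC.2 _ (hmem _)]; exact one_ne_zero)
      (fun k => hC.onCycle hW0 hW1 (hmem k)) hl
  have h := ge_of_tendsto ((hv l).dist (tendsto_const_nhds (x := (S.next W)^[l] y))) hld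
  rw [heq, dist_self] at h
  linarith

/-- From points near a repelling `W`-cycle there start paths that shadow the cycle. -/
lemma IsWCycle.exists_shadowing (hS : S.IsEndomorphismCase ∨ S.IsIFSCase)
    (hW0 : ∀ x, 0 ≤ W x) (hW1 : S.ruelle W 1 = 1) (hTZ : S.TZ W) (hC : S.IsWCycle W C)
    (hrep : S.IsRepelling C) :
    ∃ c : ℝ, 0 < c ∧ c < 1 ∧ ∀ ε > 0, ∃ δ > 0, ∀ y ∈ C, ∀ x, dist x y < δ → ∃ ω ∈ S.paths x,
      (∀ n : ℕ, dist (ω (n * C.card)).point y ≤ c ^ n * dist x y) ∧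
      ∀ m, dist (ω m).point ((S.next W)^[m] y) < ε := by
  obtain ⟨c, δ₀, hc0, hc1, hδ₀, hP⟩ := hrep.exists_uniform
  refine ⟨c, hc0, hc1, fun ε hε => ?_⟩
  -- Repulsion controls only the multiples of `C.card`; the closing radius controls the times in
  -- between, block by block.
  obtain ⟨δ₁, hδ₁, hclose⟩ := exists_uniform_radius (C := C) (P := fun y δ => ∀ w : ℕ → X,
    (∀ k < C.card, S.Step (w k) (w (k + 1))) → dist (w 0) y < δ → dist (w C.card) y < δ →
      ∀ k ≤ C.card, dist (w k) ((S.next W)^[k] y) < ε)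
    (fun y δ δ' hle h w hw h0 hp => h w hw (h0.trans_le hle) (hp.trans_le hle))
    (fun y hy => hC.exists_closing_radius hS hW0 hW1 hTZ hy C.card hε)
  refine ⟨min δ₀ δ₁, lt_min hδ₀ hδ₁, fun y hy x hx => ?_⟩
  obtain ⟨ω, hω, hgeo⟩ := hP y hy x (hx.trans_le (min_le_left _ _))
  have hpow : ∀ n : ℕ, dist (ω (n * C.card)).point y ≤ c ^ n * dist x y := fun n => by
    induction n with
    | zero => simp [S.point_zero_of_mem_paths hω]
    | succ n ih =>
      refine (hgeo n).trans ?_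
      rw [pow_succ', mul_assoc]
      exact mul_le_mul_of_nonneg_left ih hc0.le
  have hlt : ∀ n : ℕ, dist (ω (n * C.card)).point y < δ₁ := fun n =>
    ((hpow n).trans (mul_le_of_le_one_left dist_nonneg (pow_le_one₀ hc0.le hc1.le))).trans_lt
      (hx.trans_le (min_le_right _ _))
  refine ⟨ω, hω, hpow, fun m => ?_⟩
  have h := hclose y hy (fun k => (ω (m / C.card * C.card + k)).point)
    (fun k _ => S.step_of_mem_paths hω _) (by simpa using hlt _)
    (by simpa [Nat.succ_mul] using hlt (m / C.card + 1)) (m % C.card)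
    (Nat.mod_lt _ hC.1.1.card_pos).le
  have e : m / C.card * C.card + m % C.card = m := Nat.div_add_mod' m _
  have e' := hC.iterate_mul_add hW0 hW1 hy (m / C.card) (m % C.card)
  rw [e] at e'
  simp only [e] at h
  rwa [e']

/-- The exponent is an integer quotient, constant on blocks of length `p`; this gives `p` copies of
a geometric series. -/
lemma sum_pow_div_le {c : ℝ} (hc0 : 0 ≤ c) (hc1 : c < 1) {p : ℕ} (hp : 0 < p) (N : ℕ) :
    ∑ m ∈ Finset.range N, c ^ (m / p) ≤ p / (1 - c) := by
  have hblock : ∀ n : ℕ, ∑ m ∈ Finset.range (n * p), c ^ (m / p)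
      = p * ∑ k ∈ Finset.range n, c ^ k := fun n => by
    induction n with
    | zero => simp
    | succ n ih =>
      rw [Nat.succ_mul, Finset.sum_range_add, ih, Finset.sum_range_succ, mul_add]
      congr 1
      rw [Finset.sum_congr rfl (g := fun _ => c ^ n), Finset.sum_const, Finset.card_range,
        nsmul_eq_mul]
      intro k hk
      rw [Nat.mul_comm n p, Nat.mul_add_div hp, Nat.div_eq_of_lt (Finset.mem_range.1 hk), add_zero]
  calc ∑ m ∈ Finset.range N, c ^ (m / p) ≤ ∑ m ∈ Finset.range (N * p), c ^ (m / p) :=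
        Finset.sum_le_sum_of_subset_of_nonneg
          (Finset.range_mono (Nat.le_mul_of_pos_right _ hp)) fun _ _ _ => by positivity
    _ = p * ∑ k ∈ Finset.range N, c ^ k := hblock N
    _ ≤ p * (1 - c)⁻¹ := by
        refine mul_le_mul_of_nonneg_left ?_ (Nat.cast_nonneg _)
        rw [← tsum_geometric_of_lt_one hc0 hc1]
        exact (summable_geometric_of_lt_one hc0 hc1).sum_le_tsum _ fun _ _ => by positivity
    _ = p / (1 - c) := rfl

lemma one_sub_sum_le_prod {a : ℕ → ℝ} (h0 : ∀ n, 0 ≤ a n) (h1 : ∀ n, a n ≤ 1) (N : ℕ) :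
    1 - ∑ n ∈ Finset.range N, (1 - a n) ≤ ∏ n ∈ Finset.range N, a n := by
  induction N with
  | zero => simp
  | succ N ih =>
    rw [Finset.sum_range_succ, Finset.prod_range_succ]
    have hp : ∏ n ∈ Finset.range N, a n ≤ 1 :=
      Finset.prod_le_one (fun n _ => h0 n) fun n _ => h1 n
    nlinarith [h0 N, h1 N]

/-- From points near a repelling `W`-cycle there start paths that converge to the cycle and have
nearly full mass. -/
lemma IsWCycle.exists_path_of_near (hS : S.IsEndomorphismCase ∨ S.IsIFSCase)
    (hW0 : ∀ x, 0 ≤ W x) (hWlip : ∃ K, LipschitzWith K W) (hW1 : S.ruelle W 1 = 1)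
    (hTZ : S.TZ W) (hC : S.IsWCycle W C) (hrep : S.IsRepelling C) {η : ℝ} (hη : 0 < η) :
    ∃ δ > 0, ∀ y ∈ C, ∀ x, dist x y < δ → ∃ ω ∈ S.paths x,
      Tendsto (fun m => dist (ω m).point ((S.next W)^[m] y)) atTop (𝓝 0) ∧
      ∀ N, 1 - η ≤ ∏ m ∈ Finset.range N, W (ω (m + 1)).point := by
  obtain ⟨K', hK'⟩ := hWlip
  obtain ⟨K, hK0, hK⟩ : ∃ K : ℝ, 0 < K ∧ ∀ x, ∀ y ∈ C, 1 - W x ≤ K * dist x y := by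
    refine ⟨K' + 1, by positivity, fun x y hy => ?_⟩
    have h := hK'.dist_le_mul y x
    rw [Real.dist_eq, hC.2 y hy, dist_comm] at h
    nlinarith [le_abs_self (1 - W x), dist_nonneg (x := x) (y := y)]
  have hp := hC.1.1.card_pos
  have hmem := fun {y} (hy : y ∈ C) => hC.iterate_mem hW0 hW1 hy
  obtain ⟨c, hc0, hc1, hsh⟩ := hC.exists_shadowing hS hW0 hW1 hTZ hrep
  have hhalf : ∀ x, ∀ y ∈ C, dist x y < 1 / (2 * K) → 1 / 2 < W x := fun x y hy hxy => by
    rw [lt_div_iff₀ (by positivity)] at hxy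
    linarith [hK x y hy]
  obtain ⟨δ₁, hδ₁, hsh₁⟩ := hsh (1 / (2 * K)) (by positivity)
  have hp' : (0 : ℝ) < C.card := Nat.cast_pos.2 hp
  have h1c : 0 < 1 - c := by linarith
  -- The first two bounds allow shadowing to be restarted at any time and keep the weights above `1
  -- / 2`; the third makes the total defect of the weights at most `η`.
  set ε := min (min δ₁ (1 / (2 * K))) (η * (1 - c) / (K * C.card)) with hε
  have hε0 : 0 < ε := by positivity
  obtain ⟨δ, hδ, hshδ⟩ := hsh ε hε0
  refine ⟨δ, hδ, fun y hy x hx => ?_⟩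
  obtain ⟨ω, hω, -, hclose⟩ := hshδ y hy x hx
  -- For the residue `k`, a shadowing path started at the point of `ω k` decays at the multiples of
  -- `C.card`. By `walk_unique` it visits the same points as `ω` shifted by `k`.
  have hgeo : ∀ m, dist (ω m).point ((S.next W)^[m] y) ≤ c ^ (m / C.card) * ε := by
    intro m
    set k := m % C.card
    set n := m / C.card
    have hkm : n * C.card + k = m := Nat.div_add_mod' m _
    obtain ⟨ω', hω', hgeo', hclose'⟩ := hsh₁ _ (hmem hy k) (ω k).point
      ((hclose k).trans_le ((min_le_left _ _).trans (min_le_left _ _)))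
    have heq := walk_unique hW0 hW1 (u := fun j => (ω (j + k)).point) (v := fun j => (ω' j).point)
      (by simp [S.point_zero_of_mem_paths hω'])
      (fun j => by rw [Nat.add_right_comm]; exact S.step_of_mem_paths hω _)
      (S.step_of_mem_paths hω')
      (fun j => hhalf _ _ (hmem hy _)
        ((hclose _).trans_le ((min_le_left _ _).trans (min_le_right _ _))))
      (fun j => hhalf _ _ (hmem (hmem hy k) _) (hclose' _)) (n * C.card)
    have h := hgeo' n
    rw [← heq, hkm] at h
    rw [← hkm, hC.iterate_mul_add hW0 hW1 hy, hkm]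
    exact h.trans (mul_le_mul_of_nonneg_left (hclose k).le (by positivity))
  refine ⟨ω, hω, ?_, fun N => ?_⟩
  · refine squeeze_zero (fun _ => dist_nonneg) hgeo ?_
    rw [← zero_mul ε]
    exact ((tendsto_pow_atTop_nhds_zero_of_lt_one hc0.le hc1).comp
      (Nat.tendsto_div_const_atTop hp.ne')).mul_const ε
  · refine le_trans ?_ (one_sub_sum_le_prod (fun _ => hW0 _)
      (fun m => weight_le_one hW0 hW1 (S.step_of_mem_paths hω m)) N)
    have hb : ∑ m ∈ Finset.range N, (1 - W (ω (m + 1)).point) ≤ η := by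
      have h1 : ∀ m, 1 - W (ω (m + 1)).point ≤ K * ε * c ^ (m / C.card) := fun m => by
        refine (hK _ _ (hmem hy (m + 1))).trans ?_
        have h2 : c ^ ((m + 1) / C.card) ≤ c ^ (m / C.card) :=
          pow_le_pow_of_le_one hc0.le hc1.le (Nat.div_le_div_right (Nat.le_succ m))
        calc K * dist (ω (m + 1)).point ((S.next W)^[m + 1] y)
            ≤ K * (c ^ (m / C.card) * ε) := by
              gcongr
              exact (hgeo _).trans (by gcongr)
          _ = K * ε * c ^ (m / C.card) := by ring
      calc ∑ m ∈ Finset.range N, (1 - W (ω (m + 1)).point)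
          ≤ ∑ m ∈ Finset.range N, K * ε * c ^ (m / C.card) := Finset.sum_le_sum fun m _ => h1 m
        _ = K * ε * ∑ m ∈ Finset.range N, c ^ (m / C.card) := by rw [Finset.mul_sum]
        _ ≤ K * (η * (1 - c) / (K * C.card)) * (C.card / (1 - c)) := by
            gcongr
            · exact min_le_right _ _
            · exact sum_pow_div_le hc0.le hc1 hp N
        _ = η := by field_simp
    linarith

/-- Repelling `W`-cycles are isolated from each other. -/
lemma IsWCycle.exists_isolating_radius (hS : S.IsEndomorphismCase ∨ S.IsIFSCase)
    (hW0 : ∀ x, 0 ≤ W x) (hWlip : ∃ K, LipschitzWith K W) (hW1 : S.ruelle W 1 = 1)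
    (hTZ : S.TZ W) (hC : S.IsWCycle W C) (hrep : S.IsRepelling C) :
    ∃ δ > 0, ∀ y ∈ C, ∀ D, S.IsWCycle W D → ∀ x ∈ D, dist x y < δ → D = C := by
  obtain ⟨δ, hδ, h⟩ := hC.exists_path_of_near hS hW0 hWlip hW1 hTZ hrep (η := 1 / 2) (by norm_num)
  refine ⟨δ, hδ, fun y hy D hD x hx hxy => ?_⟩
  obtain ⟨ω, hω, hlim, hprod⟩ := h y hy x hxy
  -- From a point of `D` only `next` has nonzero weight, so this path never leaves the finite set
  -- `D`, which then contains its limit `y`.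
  have hWne : ∀ m, W (ω (m + 1)).point ≠ 0 := fun m h0 => by
    have := hprod (m + 1)
    rw [Finset.prod_range_succ, h0, mul_zero] at this
    norm_num at this
  have hmem : ∀ m, (ω m).point ∈ D := fun m => by
    induction m with
    | zero => rwa [S.point_zero_of_mem_paths hω]
    | succ m ih =>
      obtain ⟨h1, h2⟩ := hD.step_next ih
      rw [eq_next hW0 hW1 h1 h2 (S.step_of_mem_paths hω m) (hWne m)]
      exact hD.iterate_mem hW0 hW1 ih 1
  have hlim' : Tendsto (fun n => (ω (n * C.card)).point) atTop (𝓝 y) := by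
    rw [tendsto_iff_dist_tendsto_zero]
    refine (hlim.comp (tendsto_id.atTop_mul_const' hC.1.1.card_pos)).congr fun n => ?_
    simpa using congrArg (dist (ω (n * C.card)).point) (hC.iterate_mul_add hW0 hW1 hy n 0)
  exact hD.eq_of_mem hW0 hW1 hC (D.finite_toSet.isClosed.mem_of_tendsto hlim'
    (Eventually.of_forall fun n => hmem _)) hy

end Topology

/-! ### The Ruelle operator and Cesàro limits. -/

section Ruelle

variable {X I : Type*} {S : BranchSystem X I} {W : X → ℝ}

lemma ruelle_mono (hW0 : ∀ x, 0 ≤ W x) {f g : X → ℝ} (h : f ≤ g) :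
    S.ruelle W f ≤ S.ruelle W g :=
  fun _ => Finset.sum_le_sum fun _ _ => mul_le_mul_of_nonneg_left (h _) (hW0 _)

lemma iterate_ruelle_mono (hW0 : ∀ x, 0 ≤ W x) {f g : X → ℝ} (h : f ≤ g) (k : ℕ) :
    (S.ruelle W)^[k] f ≤ (S.ruelle W)^[k] g :=
  Monotone.iterate (fun _ _ => ruelle_mono hW0) k h

lemma ruelle_smul (c : ℝ) (f : X → ℝ) : S.ruelle W (c • f) = c • S.ruelle W f := by
  ext x
  simp only [ruelle, Pi.smul_apply, smul_eq_mul, Finset.mul_sum]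
  exact Finset.sum_congr rfl fun _ _ => by ring

lemma iterate_ruelle_smul (c : ℝ) (f : X → ℝ) (k : ℕ) :
    (S.ruelle W)^[k] (c • f) = c • (S.ruelle W)^[k] f :=
  Function.Commute.iterate_left (f := S.ruelle W) (g := fun f => c • f)
    (ruelle_smul c) k f

lemma ruelle_sum {ι : Type*} (s : Finset ι) (f : ι → X → ℝ) :
    S.ruelle W (∑ k ∈ s, f k) = ∑ k ∈ s, S.ruelle W (f k) := by
  ext x
  simp only [ruelle, Finset.sum_apply, Finset.mul_sum]
  exact Finset.sum_comm

lemma iterate_ruelle_const (hW1 : S.ruelle W 1 = 1) (c : ℝ) (k : ℕ) :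
    (S.ruelle W)^[k] (c • 1) = c • 1 := by
  rw [iterate_ruelle_smul, Function.iterate_fixed hW1]

/-- Limits of Cesàro averages of the iterates are harmonic. -/
lemma ruelle_eq_of_tendsto_average (hW0 : ∀ x, 0 ≤ W x) (hW1 : S.ruelle W 1 = 1)
    {f g : X → ℝ} (h0 : 0 ≤ f) (h1 : f ≤ 1)
    (h : ∀ x, Tendsto (fun n : ℕ => (n : ℝ)⁻¹ * ∑ k ∈ Finset.range n, (S.ruelle W)^[k] f x)
      atTop (𝓝 (g x))) : S.ruelle W g = g := by
  ext x
  have hb : ∀ k, |(S.ruelle W)^[k] f x| ≤ 1 := fun k => by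
    have h2 := iterate_ruelle_mono (S := S) hW0 (f := (0 : ℝ) • 1) (by simpa using h0) k x
    have h3 := iterate_ruelle_mono (S := S) hW0 h1 k x
    rw [iterate_ruelle_const hW1] at h2
    rw [Function.iterate_fixed hW1] at h3
    rw [abs_le]
    simp only [zero_smul, Pi.zero_apply, Pi.one_apply] at h2 h3
    exact ⟨by linarith, h3⟩
  have hlim1 : Tendsto (fun n : ℕ => S.ruelle W
      (fun x => (n : ℝ)⁻¹ * ∑ k ∈ Finset.range n, (S.ruelle W)^[k] f x) x) atTop
      (𝓝 (S.ruelle W g x)) :=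
    tendsto_finsetSum _ fun i _ => (h _).const_mul _
  refine tendsto_nhds_unique hlim1 ?_
  -- Applying the operator shifts the sum by one index; the two boundary terms contribute at most `2
  -- / n`.
  have heq : ∀ n : ℕ, S.ruelle W
      (fun x => (n : ℝ)⁻¹ * ∑ k ∈ Finset.range n, (S.ruelle W)^[k] f x) x
      = (n : ℝ)⁻¹ * ∑ k ∈ Finset.range n, (S.ruelle W)^[k] f x
        + (n : ℝ)⁻¹ * ((S.ruelle W)^[n] f x - f x) := fun n => by
    have e : (fun x => (n : ℝ)⁻¹ * ∑ k ∈ Finset.range n, (S.ruelle W)^[k] f x)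
        = (n : ℝ)⁻¹ • ∑ k ∈ Finset.range n, (S.ruelle W)^[k] f := by
      ext z
      simp
    rw [e, ruelle_smul, ruelle_sum]
    simp only [← Function.iterate_succ_apply' (S.ruelle W), Pi.smul_apply, smul_eq_mul,
      Finset.sum_apply]
    have h2 := Finset.sum_range_succ' (fun k => (S.ruelle W)^[k] f x) n
    rw [Finset.sum_range_succ] at h2
    simp only [Function.iterate_zero, id] at h2
    rw [← mul_add]
    congr 1
    linarith
  simp only [heq]
  rw [← add_zero (g x)]
  refine (h x).add (squeeze_zero_norm (a := fun n : ℕ => 2 * (n : ℝ)⁻¹) (fun n => ?_) ?_)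
  · rw [norm_mul, norm_inv, Real.norm_natCast, mul_comm]
    refine mul_le_mul_of_nonneg_right ?_ (by positivity)
    have h2 := abs_le.1 (hb n)
    have h3 := abs_le.1 (hb 0)
    simp only [Function.iterate_zero, id] at h3
    rw [Real.norm_eq_abs, abs_le]
    constructor <;> linarith [h2.1, h2.2, h3.1, h3.2]
  · simpa using (tendsto_inv_atTop_nhds_zero_nat (𝕜 := ℝ)).const_mul 2

end Ruelle

/-! ### Finiteness of the `W`-cycles and the minimum principle. -/

section Finiteness

variable {X I : Type*} [MetricSpace X] [CompactSpace X] {S : BranchSystem X I} {W : X → ℝ}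

/-- There are only finitely many points on `W`-cycles. -/
lemma finite_wCyclePoints (hS : S.IsEndomorphismCase ∨ S.IsIFSCase)
    (hW0 : ∀ x, 0 ≤ W x) (hWlip : ∃ K, LipschitzWith K W) (hW1 : S.ruelle W 1 = 1)
    (hTZ : S.TZ W)
    (hC : ∃ C, S.IsWCycle W C ∧ ∀ x, ((C : Set X) ∩ closure (S.backwardOrbit x)).Nonempty)
    (hrep : ∀ C, S.IsWCycle W C → S.IsRepelling C) :
    {y | ∃ C, S.IsWCycle W C ∧ y ∈ C}.Finite := by
  set P := {y | ∃ C, S.IsWCycle W C ∧ y ∈ C} with hP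
  by_contra hinf
  have : (cofinite ⊓ 𝓟 P).NeBot := cofinite_inf_principal_neBot_iff.2 hinf
  -- The limit `x` of this nonprincipal ultrafilter on `P` inherits an orbit of weight one, since
  -- `W` is continuous and `Step` is closed.
  obtain ⟨𝒰, h𝒰⟩ := Ultrafilter.exists_le (cofinite ⊓ 𝓟 P)
  have hP𝒰 : ∀ᶠ y in (𝒰 : Filter X), y ∈ P := h𝒰 (mem_inf_of_right (mem_principal_self P))
  have hnot : ∀ C : Finset X, ¬ ∀ᶠ y in (𝒰 : Filter X), y ∈ C := fun C h => by
    have h2 : ∀ᶠ y in (𝒰 : Filter X), y ∉ C :=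
      h𝒰 (mem_inf_of_left C.finite_toSet.compl_mem_cofinite)
    obtain ⟨y, h3, h4⟩ := (h.and h2).exists
    exact h4 h3
  have hWc : Continuous W := hWlip.choose_spec.continuous
  set x := 𝒰.lim
  have hx : Tendsto id (𝒰 : Filter X) (𝓝 x) := 𝒰.le_nhds_lim
  have hPit : ∀ k, ∀ᶠ y in (𝒰 : Filter X), (S.next W)^[k] y ∈ P := fun k => hP𝒰.mono
    fun y ⟨C, hC, hy⟩ => ⟨C, hC, hC.iterate_mem hW0 hW1 hy k⟩
  have hlimW : ∀ (k : ℕ) (z : X), Tendsto (S.next W)^[k] (𝒰 : Filter X) (𝓝 z) → W z = 1 :=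
    fun k z hz => tendsto_nhds_unique ((hWc.tendsto z).comp hz)
      (tendsto_const_nhds.congr' ((hPit k).mono fun y ⟨C, hC, hy⟩ => (hC.2 _ hy).symm))
  have hlimS : ∀ (k : ℕ) (z : X), Tendsto (S.next W)^[k] (𝒰 : Filter X) (𝓝 z) →
      Tendsto (S.next W)^[k + 1] (𝒰 : Filter X) (𝓝 (S.next W z)) ∧ S.Step z (S.next W z) := by
    intro k z hz
    have hv : Tendsto (S.next W)^[k + 1] (𝒰 : Filter X) (𝓝 (𝒰.map (S.next W)^[k + 1]).lim) :=
      (𝒰.map (S.next W)^[k + 1]).le_nhds_lim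
    have hst : S.Step z (𝒰.map (S.next W)^[k + 1]).lim := by
      refine step_of_tendsto hS ((hPit k).mono fun y ⟨C, hC, hy⟩ => ?_) hz hv
      rw [Function.iterate_succ_apply']
      exact (hC.step_next hy).1
    have h1 := hlimW _ _ hv
    have e := eq_next hW0 hW1 hst h1 hst (by rw [h1]; exact one_ne_zero)
    rw [e] at hst hv
    exact ⟨hv, hst⟩
  have hlim : ∀ k, Tendsto (S.next W)^[k] (𝒰 : Filter X) (𝓝 ((S.next W)^[k] x)) := fun k => by
    induction k with
    | zero => exact hx
    | succ k ih =>
      rw [Function.iterate_succ_apply' _ k x]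
      exact (hlimS k _ ih).1
  have hstep : ∀ k, S.Step ((S.next W)^[k] x) ((S.next W)^[k + 1] x) := fun k => by
    rw [Function.iterate_succ_apply' _ k x]
    exact (hlimS k _ (hlim k)).2
  have hone : ∀ k, W ((S.next W)^[k] x) = 1 := fun k => hlimW k _ (hlim k)
  -- no iterate of `x` is close to a `W`-cycle
  have hfar : ∀ C, S.IsWCycle W C → ∃ δ > 0, ∀ y ∈ C, ∀ k, δ ≤ dist ((S.next W)^[k] x) y := by
    intro C hC
    obtain ⟨δ, hδ, h⟩ := hC.exists_isolating_radius hS hW0 hWlip hW1 hTZ (hrep C hC)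
    refine ⟨δ, hδ, fun y hy k => ?_⟩
    by_contra! hlt
    have hev := ((hlim k).dist (tendsto_const_nhds (x := y))).eventually (gt_mem_nhds hlt)
    refine hnot C ((hP𝒰.and hev).mono fun z ⟨⟨D, hD, hz⟩, hzy⟩ => ?_)
    rwa [← h y hy D hD _ (hD.iterate_mem hW0 hW1 hz k) hzy]
  by_cases hon : ∀ k, S.OnCycle ((S.next W)^[k] x)
  · obtain ⟨C, hC, hxC⟩ := exists_isWCycle_of_onCycle hTZ hstep (fun k => hone _) hon
    obtain ⟨δ, hδ, h⟩ := hfar C hC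
    have := h x hxC 0
    simp only [Function.iterate_zero, id, dist_self] at this
    linarith
  · push Not at hon
    obtain ⟨k, hk⟩ := hon
    obtain ⟨n₀, hn₀⟩ := hTZ.eventually_ne_zero _ hk
    have hmem : (S.next W)^[n₀ + k] x ∈ S.preimages n₀ ((S.next W)^[k] x) := by
      have := S.mem_preimages_of_walk (v := fun j => (S.next W)^[j] x) (p := n₀ + k)
        (fun j _ => hstep j) (Nat.le_add_left k n₀) le_rfl
      simpa using this
    -- Beyond level `n₀` no weight vanishes, yet the step to `next` has weight one and leaves
    -- nothing for other points. The backward orbit thus stays in the orbit of `x`, which `hfar`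
    -- keeps away from `C`.
    have huniq : ∀ n, S.preimages n ((S.next W)^[n₀ + k] x) ⊆ {(S.next W)^[n + (n₀ + k)] x} := by
      intro n
      induction n with
      | zero => simp [preimages]
      | succ n ih =>
        rintro z hz
        have hz0 : W z ≠ 0 := hn₀ (n₀ + (n + 1)) (Nat.le_add_right _ _) z
          (S.mem_preimages_add hmem hz)
        obtain ⟨u, hu, huz⟩ := hz
        rw [Set.mem_singleton_iff.1 (ih hu)] at huz
        rw [Set.mem_singleton_iff, Nat.add_right_comm, Function.iterate_succ_apply' _ (n + (n₀ + k))]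
        exact eq_next hW0 hW1 (hstep _) (hone _) huz hz0
    obtain ⟨C, hC, hmeet⟩ := hC
    obtain ⟨y, hy, hycl⟩ := hmeet ((S.next W)^[n₀ + k] x)
    obtain ⟨δ, hδ, h⟩ := hfar C hC
    obtain ⟨z, hz, hyz⟩ := Metric.mem_closure_iff.1 hycl δ hδ
    simp only [backwardOrbit, Set.mem_iUnion] at hz
    obtain ⟨n, -, hz⟩ := hz
    rw [Set.mem_singleton_iff.1 (huniq n hz), dist_comm] at hyz
    exact absurd (h y hy _) (not_le.2 hyz)

/-- The minimum principle: a continuous harmonic function that is `1` on all `W`-cycles is at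
least `1`. -/
lemma one_le_of_harmonic (hW0 : ∀ x, 0 ≤ W x) (hW1 : S.ruelle W 1 = 1) (hTZ : S.TZ W)
    (hC : ∃ C, S.IsWCycle W C ∧ ∀ x, ((C : Set X) ∩ closure (S.backwardOrbit x)).Nonempty)
    {g : X → ℝ} (hg : Continuous g) (hharm : S.ruelle W g = g)
    (hone : ∀ C, S.IsWCycle W C → ∀ y ∈ C, g y = 1) (x : X) : 1 ≤ g x := by
  have : Nonempty X := ⟨x⟩
  obtain ⟨x₀, -, hmin⟩ := isCompact_univ.exists_isMinOn Set.univ_nonempty hg.continuousOn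
  have hmin : ∀ z, g x₀ ≤ g z := fun z => hmin (Set.mem_univ z)
  suffices h : g x₀ = 1 from h ▸ hmin x
  -- A weighted average of the nonnegative function `g - g x₀` vanishes at `u`, so the minimum
  -- spreads along every step of nonzero weight.
  have hprop : ∀ u v, g u = g x₀ → S.Step u v → W v ≠ 0 → g v = g x₀ := by
    rintro u _ hu ⟨i, hi, rfl⟩ hWi
    have h0 : ∑ i ∈ S.branches u, W (S.map i u) * (g (S.map i u) - g x₀) = 0 := by
      simp only [mul_sub, Finset.sum_sub_distrib, ← Finset.sum_mul, sum_weight hW1, one_mul]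
      rw [sub_eq_zero, ← hu]
      exact congrFun hharm u
    have h1 := (Finset.sum_eq_zero_iff_of_nonneg fun j _ =>
      mul_nonneg (hW0 _) (sub_nonneg.2 (hmin (S.map j u)))).1 h0 i hi
    exact sub_eq_zero.1 ((mul_eq_zero.1 h1).resolve_left hWi)
  by_cases hon : ∀ u, g u = g x₀ → S.OnCycle u
  · have hnext : ∀ u, g u = g x₀ → S.Step u (S.next W u) ∧ W (S.next W u) = 1 := by
      intro u hu
      obtain ⟨p, hp, hup⟩ := hon u hu
      obtain ⟨v, hv0, hvp, hv⟩ := S.exists_walk_of_mem_preimages hup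
      obtain ⟨i, hi, ei⟩ := hv 0 hp
      rw [hv0] at hi ei
      have hret : u ∈ S.preimages (p - 1) (S.map i u) := by
        rw [ei]
        simpa [hvp] using S.mem_preimages_of_walk hv hp le_rfl
      refine next_spec ⟨i, hi, rfl⟩ ?_
      -- Another branch of nonzero weight would end in the minimum set, hence on a cycle, against
      -- transversality. The branch `i` carries all the weight.
      rw [← sum_weight hW1 u, Finset.sum_eq_single_of_mem i hi]
      intro j hj hji
      by_contra hne
      rcases hTZ.transversal u i hi ⟨_, hret⟩ j hj hji with h | h
      · exact h (hon _ (hprop u _ hu ⟨j, hj, rfl⟩ hne))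
      · exact hne h
    have hM : ∀ k, g ((S.next W)^[k] x₀) = g x₀ := fun k => by
      induction k with
      | zero => rfl
      | succ k ih =>
        rw [Function.iterate_succ_apply']
        obtain ⟨h1, h2⟩ := hnext _ ih
        exact hprop _ _ ih h1 (by simp [h2])
    obtain ⟨C, hC, hx₀⟩ := exists_isWCycle_of_onCycle (x := x₀) hTZ
      (fun k => by rw [Function.iterate_succ_apply']; exact (hnext _ (hM k)).1)
      (fun k => by rw [Function.iterate_succ_apply']; exact (hnext _ (hM k)).2)
      (fun k => hon _ (hM k))
    exact hone C hC x₀ hx₀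
  · push Not at hon
    obtain ⟨u, hu, hoff⟩ := hon
    obtain ⟨n₀, hn₀⟩ := hTZ.eventually_ne_zero u hoff
    -- Steps of positive weight lead to level `n₀` inside the minimum set. From there on no weight
    -- vanishes, so the whole backward orbit of `u'` attains the minimum.
    obtain ⟨u', hu', hgu'⟩ : ∃ u' ∈ S.preimages n₀ u, g u' = g x₀ := by
      clear hn₀
      induction n₀ with
      | zero => exact ⟨u, rfl, hu⟩
      | succ n ih =>
        obtain ⟨v, hv, hgv⟩ := ih
        obtain ⟨w, hvw, hw⟩ := exists_step_pos hW0 hW1 v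
        exact ⟨w, ⟨v, hv, hvw⟩, hprop v w hgv hvw hw.ne'⟩
    have hall : ∀ n, ∀ z ∈ S.preimages n u', g z = g x₀ := fun n => by
      induction n with
      | zero => rintro z rfl; exact hgu'
      | succ n ih =>
        intro z hz
        have hz0 := hn₀ (n₀ + (n + 1)) (Nat.le_add_right _ _) z (S.mem_preimages_add hu' hz)
        obtain ⟨v, hv, hvz⟩ := hz
        exact hprop v z (ih v hv) hvz hz0
    obtain ⟨C, hC, hmeet⟩ := hC
    obtain ⟨y, hy, hycl⟩ := hmeet u'
    have hcl : IsClosed {z | g z = g x₀} := isClosed_eq hg continuous_const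
    have hsub : S.backwardOrbit u' ⊆ {z | g z = g x₀} := fun z hz => by
      simp only [backwardOrbit, Set.mem_iUnion] at hz
      obtain ⟨n, -, hz⟩ := hz
      exact hall n z hz
    rw [← hone C hC y hy]
    exact (closure_minimal hsub hcl hycl).symm

/-- For bump functions around the `W`-cycles the Cesàro averages tend to at least one. -/
lemma exists_tendsto_average (hW0 : ∀ x, 0 ≤ W x) (hW1 : S.ruelle W 1 = 1)
    (hcont : ∀ f : X → ℝ, Continuous f → Continuous (S.ruelle W f)) (hTZ : S.TZ W)
    (hC : ∃ C, S.IsWCycle W C ∧ ∀ x, ((C : Set X) ∩ closure (S.backwardOrbit x)).Nonempty)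
    (hcesaro : ∀ f : X → ℝ, (∃ K, LipschitzWith K f) → ∃ g : X → ℝ,
      TendstoUniformly (fun (n : ℕ) x => (n : ℝ)⁻¹ * ∑ k ∈ Finset.range n, (S.ruelle W)^[k] f x)
        g atTop)
    {f : X → ℝ} (hf : ∃ K, LipschitzWith K f) (h0 : 0 ≤ f) (h1 : f ≤ 1)
    (hone : ∀ C, S.IsWCycle W C → ∀ y ∈ C, f y = 1) (x : X) :
    ∃ a, 1 ≤ a ∧ Tendsto (fun n : ℕ => (n : ℝ)⁻¹ * ∑ k ∈ Finset.range n, (S.ruelle W)^[k] f x)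
      atTop (𝓝 a) := by
  obtain ⟨g, hg⟩ := hcesaro f hf
  have hlim := fun x => hg.tendsto_at x
  have hcontk : ∀ k, Continuous ((S.ruelle W)^[k] f) := fun k => by
    induction k with
    | zero => exact hf.choose_spec.continuous
    | succ k ih =>
      rw [Function.iterate_succ_apply']
      exact hcont _ ih
  have hgc : Continuous g := hg.continuous <| Frequently.of_forall fun n =>
    continuous_const.mul (continuous_finsetSum _ fun k _ => hcontk k)
  refine ⟨g x, one_le_of_harmonic hW0 hW1 hTZ hC hgc
    (ruelle_eq_of_tendsto_average hW0 hW1 h0 h1 hlim) (fun C hC y hy => ?_) x, hlim x⟩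
  -- On a `W`-cycle the operator is composition with `next`.
  have hk : ∀ k, ∀ y ∈ C, (S.ruelle W)^[k] f y = 1 := fun k => by
    induction k with
    | zero => exact hone C hC
    | succ k ih =>
      intro y hy
      obtain ⟨h2, h3⟩ := hC.step_next hy
      rw [Function.iterate_succ_apply', ruelle_apply_eq_next hW0 hW1 h2 h3]
      exact ih _ (hC.iterate_mem hW0 hW1 hy 1)
  refine tendsto_nhds_unique (hlim y) (tendsto_const_nhds.congr' ?_)
  filter_upwards [eventually_gt_atTop 0] with n hn
  rw [Finset.sum_congr rfl fun k _ => hk k y hy]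
  simp [hn.ne']

end Finiteness

end BranchSystem

/-! ### Masses of single paths. -/

/-- Lower bound for the mass of a cylinder under a partial trajectory kernel. -/
lemma ProbabilityTheory.Kernel.prod_le_partialTraj_singleton {X : ℕ → Type*}
    [∀ n, MeasurableSpace (X n)] [∀ n, MeasurableSingletonClass (X n)]
    (κ : (n : ℕ) → Kernel (Π i : Finset.Iic n, X i) (X (n + 1))) [∀ n, IsMarkovKernel (κ n)]
    (ω : (n : ℕ) → X n) (n : ℕ) :
    ∏ m ∈ Finset.range n, κ m (Preorder.frestrictLe m ω) {ω (m + 1)}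
      ≤ Kernel.partialTraj κ 0 n (Preorder.frestrictLe 0 ω) {Preorder.frestrictLe n ω} := by
  induction n with
  | zero =>
    rw [Kernel.partialTraj_self, Kernel.id_apply]
    simp
  | succ n ih =>
    rw [Finset.prod_range_succ, Kernel.partialTraj_succ_of_le (Nat.zero_le n),
      Kernel.map_apply' _ measurable_IicProdIoc _ (measurableSet_singleton _),
      Kernel.comp_apply' _ _ _ (measurable_IicProdIoc (measurableSet_singleton _))]
    set r := Preorder.frestrictLe n ω
    set B := IicProdIoc (X := X) n (n + 1) ⁻¹' {Preorder.frestrictLe (n + 1) ω}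
    -- Only the contribution of the exact history `r` is kept.
    refine le_trans ?_ (setLIntegral_le_lintegral {r} _)
    rw [lintegral_singleton, mul_comm]
    refine mul_le_mul' ?_ ih
    have hsub : {r} ×ˢ {MeasurableEquiv.piSingleton n (ω (n + 1))} ⊆ B := by
      rintro ⟨a, b⟩ ⟨ha, hb⟩
      rw [Set.mem_singleton_iff] at ha hb
      simp only at ha hb
      subst ha hb
      ext ⟨k, hk⟩
      simp only [IicProdIoc]
      split_ifs with h
      · rfl
      · obtain rfl : k = n + 1 := by
          have := Finset.mem_Iic.1 hk
          omega
        rfl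
    refine le_trans ?_ (measure_mono hsub)
    rw [Kernel.prod_apply, Measure.prod_prod, Kernel.id_apply,
      Measure.dirac_apply_of_mem (Set.mem_singleton _), one_mul,
      Kernel.map_apply' _ (MeasurableEquiv.piSingleton n).measurable _ (measurableSet_singleton _)]
    exact measure_mono (by simp)

namespace BranchSystem

section PathMass

variable {X I : Type*} {S : BranchSystem X I} {W : X → ℝ}

/-- The mass of the single path `ω`: the infimum of the masses of its cylinders. -/
noncomputable def pathMass (W : X → ℝ) (ω : ℕ → PathNode X I) : ENNReal :=
  ⨅ N, ∏ m ∈ Finset.range N, ENNReal.ofReal (W (ω (m + 1)).point)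

instance isProbabilityMeasure_pathMeasure (hW0 : ∀ x, 0 ≤ W x) (hW1 : S.ruelle W 1 = 1) (x : X) :
    IsProbabilityMeasure (S.pathMeasure W hW0 hW1 x) := by
  have : ∀ n, IsMarkovKernel (S.stepKernel W n) :=
    fun _ => ⟨fun _ => S.isProbabilityMeasure_stepMeasure hW0 hW1 _⟩
  unfold pathMeasure
  infer_instance

/-- A singleton is the decreasing intersection of its cylinders. The inequality suffices, since the
total measure is one. -/
lemma pathMass_le_pathMeasure (hW0 : ∀ x, 0 ≤ W x) (hW1 : S.ruelle W 1 = 1) {x : X}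
    {ω : ℕ → PathNode X I} (hω : ω ∈ S.paths x) :
    pathMass W ω ≤ S.pathMeasure W hW0 hW1 x {ω} := by
  have : ∀ n, IsMarkovKernel (S.stepKernel W n) :=
    fun _ => ⟨fun _ => S.isProbabilityMeasure_stepMeasure hW0 hW1 _⟩
  set s : ℕ → Set (ℕ → PathNode X I) := fun n =>
    Preorder.frestrictLe (π := fun _ => PathNode X I) n ⁻¹'
      {Preorder.frestrictLe (π := fun _ => PathNode X I) n ω} with hs
  have hsm : ∀ n, MeasurableSet (s n) := fun n =>
    (Preorder.measurable_frestrictLe n) (measurableSet_singleton _)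
  have hω' : {ω} = ⋂ n, s n := by
    ext ω'
    simp only [hs, Set.mem_singleton_iff, Set.mem_iInter, Set.mem_preimage]
    refine ⟨fun h n => by rw [h], fun h => ?_⟩
    ext1 n
    exact congrFun (h n) ⟨n, Finset.mem_Iic.2 le_rfl⟩
  have hanti : Antitone s := by
    intro a b hab ω' h
    simp only [hs, Set.mem_preimage, Set.mem_singleton_iff] at h ⊢
    ext1 ⟨k, hk⟩
    exact congrFun h ⟨k, Finset.mem_Iic.2 ((Finset.mem_Iic.1 hk).trans hab)⟩
  rw [hω', hanti.measure_iInter (fun n => (hsm n).nullMeasurableSet) ⟨0, measure_ne_top _ _⟩]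
  refine iInf_mono fun n => ?_
  have h0 : (fun _ => ⟨x, none⟩ : (i : Finset.Iic 0) → PathNode X I)
      = Preorder.frestrictLe (π := fun _ => PathNode X I) 0 ω := by
    ext1 ⟨k, hk⟩
    obtain rfl : k = 0 := Nat.le_zero.1 (Finset.mem_Iic.1 hk)
    exact hω.1.symm
  have h1 : S.pathMeasure W hW0 hW1 x (s n) = Kernel.partialTraj (X := fun _ => PathNode X I)
      (S.stepKernel W) 0 n (Preorder.frestrictLe (π := fun _ => PathNode X I) 0 ω)
      {Preorder.frestrictLe (π := fun _ => PathNode X I) n ω} := by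
    rw [← Kernel.traj_map_frestrictLe_apply,
      Measure.map_apply (Preorder.measurable_frestrictLe n) (measurableSet_singleton _), ← h0]
    rfl
  rw [h1]
  refine le_trans (Finset.prod_le_prod' fun m _ => ?_)
    (Kernel.prod_le_partialTraj_singleton (X := fun _ => PathNode X I) (S.stepKernel W) ω n)
  obtain ⟨i, hi, e⟩ := hω.2 m
  change _ ≤ S.stepMeasure W (ω m).point {ω (m + 1)}
  rw [stepMeasure, Measure.coe_finsetSum, Finset.sum_apply]
  refine le_trans ?_ (Finset.single_le_sum
    (f := fun i => (ENNReal.ofReal (W (S.map i (ω m).point)) •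
      Measure.dirac (⟨S.map i (ω m).point, some i⟩ : PathNode X I)) {ω (m + 1)})
    (fun _ _ => zero_le) hi)
  rw [e, Measure.smul_apply, Measure.dirac_apply_of_mem (Set.mem_singleton _), smul_eq_mul, mul_one]

/-- `A` may be uncountable and nonmeasurable; only its points need to be measurable. -/
lemma tsum_pathMass_le (hW0 : ∀ x, 0 ≤ W x) (hW1 : S.ruelle W 1 = 1) {x : X}
    {A : Set (ℕ → PathNode X I)} (hA : A ⊆ S.paths x) :
    ∑' ω : A, pathMass W ω.1 ≤ S.pathMeasure W hW0 hW1 x A := by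
  calc ∑' ω : A, pathMass W ω.1 ≤ ∑' ω : A, S.pathMeasure W hW0 hW1 x {ω.1} :=
        ENNReal.tsum_le_tsum fun ω => pathMass_le_pathMeasure hW0 hW1 (hA ω.2)
    _ ≤ S.pathMeasure W hW0 hW1 x (⋃ ω : A, {ω.1}) :=
        tsum_meas_le_meas_iUnion_of_disjoint _ (fun _ => measurableSet_singleton _)
          fun ω ω' h => by simpa using fun e => h (Subtype.ext e)
    _ = S.pathMeasure W hW0 hW1 x A := by simp

variable (S)

/-- The path that takes the branch `i` from `x` and then follows `ω`. -/
def consPath (x : X) (i : I) (ω : ℕ → PathNode X I) : ℕ → PathNode X I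
  | 0 => ⟨x, none⟩
  | 1 => ⟨S.map i x, some i⟩
  | n + 2 => ω (n + 1)

lemma point_consPath_succ {x : X} {i : I} {ω : ℕ → PathNode X I} (hω : ω ∈ S.paths (S.map i x))
    (m : ℕ) : (S.consPath x i ω (m + 1)).point = (ω m).point := by
  cases m with
  | zero => exact (S.point_zero_of_mem_paths hω).symm
  | succ m => rfl

lemma consPath_mem_paths {x : X} {i : I} (hi : i ∈ S.branches x) {ω : ℕ → PathNode X I}
    (hω : ω ∈ S.paths (S.map i x)) : S.consPath x i ω ∈ S.paths x := by
  refine ⟨rfl, fun n => ?_⟩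
  cases n with
  | zero => exact ⟨i, hi, rfl⟩
  | succ n =>
    rw [S.point_consPath_succ hω]
    exact hω.2 n

/-- The label at time `1` recovers the branch even when several branches share an end point. -/
lemma consPath_injective {x : X} {i j : I} {ω ω' : ℕ → PathNode X I}
    (hω : ω ∈ S.paths (S.map i x)) (hω' : ω' ∈ S.paths (S.map j x))
    (h : S.consPath x i ω = S.consPath x j ω') : i = j ∧ ω = ω' := by
  have hij : i = j := Option.some_injective _ (congrArg PathNode.label (congrFun h 1))
  subst hij
  refine ⟨rfl, ?_⟩
  ext1 n
  cases n with
  | zero => rw [hω.1, hω'.1]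
  | succ n => exact congrFun h (n + 2)

lemma mul_pathMass_le_pathMass_consPath (hW0 : ∀ x, 0 ≤ W x) (hW1 : S.ruelle W 1 = 1) {x : X}
    {i : I} (hi : i ∈ S.branches x) {ω : ℕ → PathNode X I} (hω : ω ∈ S.paths (S.map i x)) :
    ENNReal.ofReal (W (S.map i x)) * pathMass W ω ≤ pathMass W (S.consPath x i ω) := by
  refine le_iInf fun N => ?_
  cases N with
  | zero =>
    refine mul_le_one' (ENNReal.ofReal_le_one.2 (weight_le_one hW0 hW1 ⟨i, hi, rfl⟩)) ?_
    exact iInf_le_of_le 0 (by simp)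
  | succ N =>
    rw [Finset.prod_range_succ', mul_comm]
    refine mul_le_mul' (iInf_le_of_le N ?_) le_rfl
    simp only [S.point_consPath_succ hω]
    exact le_rfl

end PathMass

/-! ### Paths asymptotic to `W`-cycles. -/

section AsymptoticPaths

variable {X I : Type*} [MetricSpace X] (S : BranchSystem X I) (W : X → ℝ)

/-- The paths from `x` that are asymptotic to a `W`-cycle. -/
def asymptoticPaths (x : X) : Set (ℕ → PathNode X I) :=
  {ω ∈ S.paths x | ∃ C, S.IsWCycle W C ∧ ∃ y ∈ C,
    Tendsto (fun m => dist (ω m).point ((S.next W)^[m] y)) atTop (𝓝 0)}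

/-- The total mass of the individual paths that are asymptotic to a `W`-cycle. -/
noncomputable def asymptoticMass (x : X) : ENNReal :=
  ∑' ω : S.asymptoticPaths W x, pathMass W ω.1

variable {S W}

lemma consPath_mem_asymptoticPaths (hW0 : ∀ x, 0 ≤ W x) (hW1 : S.ruelle W 1 = 1) {x : X} {i : I}
    (hi : i ∈ S.branches x) {ω : ℕ → PathNode X I}
    (hω : ω ∈ S.asymptoticPaths W (S.map i x)) : S.consPath x i ω ∈ S.asymptoticPaths W x := by
  obtain ⟨hp, C, hC, y, hy, hlim⟩ := hω
  -- Time is shifted by one, so `y` is replaced by its predecessor on the cycle.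
  refine ⟨S.consPath_mem_paths hi hp, C, hC, (S.next W)^[C.card - 1] y,
    hC.iterate_mem hW0 hW1 hy _, ?_⟩
  rw [← tendsto_add_atTop_iff_nat 1]
  refine hlim.congr fun m => ?_
  have h := hC.iterate_mul_add hW0 hW1 hy 1 m
  have hp' := hC.1.1.card_pos
  rw [S.point_consPath_succ hp, ← Function.iterate_add_apply, ← h,
    show 1 * C.card + m = m + 1 + (C.card - 1) by omega]

lemma exists_mem_cycleSet_of_mem_asymptoticPaths (hW0 : ∀ x, 0 ≤ W x) (hW1 : S.ruelle W 1 = 1)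
    {x : X} {ω : ℕ → PathNode X I} (hω : ω ∈ S.asymptoticPaths W x) :
    ∃ C, S.IsWCycle W C ∧ ω ∈ S.cycleSet C x := by
  obtain ⟨hp, C, hC, y, hy, hlim⟩ := hω
  refine ⟨C, hC, hp, y, hy, ?_⟩
  rw [tendsto_iff_dist_tendsto_zero]
  refine (hlim.comp (tendsto_id.atTop_mul_const' hC.1.1.card_pos)).congr fun n => ?_
  simpa using congrArg (dist (ω (n * C.card)).point) (hC.iterate_mul_add hW0 hW1 hy n 0)

/-- Superharmonicity: prefixing a step is injective, and the prefixed path has at least the product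
mass. -/
lemma sum_mul_asymptoticMass_le (hW0 : ∀ x, 0 ≤ W x) (hW1 : S.ruelle W 1 = 1) (x : X) :
    ∑ i ∈ S.branches x, ENNReal.ofReal (W (S.map i x)) * S.asymptoticMass W (S.map i x)
      ≤ S.asymptoticMass W x := by
  rw [← Finset.sum_coe_sort, ← tsum_fintype (L := .unconditional _)]
  simp only [asymptoticMass, ← ENNReal.tsum_mul_left]
  rw [← ENNReal.tsum_sigma (fun (i : S.branches x) (ω : S.asymptoticPaths W (S.map i x)) =>
    ENNReal.ofReal (W (S.map i x)) * pathMass W ω.1)]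
  let F : (Σ i : S.branches x, S.asymptoticPaths W (S.map i x)) → S.asymptoticPaths W x :=
    fun a => ⟨S.consPath x a.1 a.2, consPath_mem_asymptoticPaths hW0 hW1 a.1.2 a.2.2⟩
  have hF : Function.Injective F := by
    rintro ⟨⟨i, hi⟩, ⟨ω, hω⟩⟩ ⟨⟨j, hj⟩, ⟨ω', hω'⟩⟩ h
    obtain ⟨rfl, rfl⟩ := S.consPath_injective hω.1 hω'.1 (congrArg Subtype.val h)
    rfl
  exact (ENNReal.tsum_le_tsum fun a =>
    S.mul_pathMass_le_pathMass_consPath hW0 hW1 a.1.2 a.2.2.1).trans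
    (ENNReal.tsum_comp_le_tsum_of_injective hF fun ω => pathMass W ω.1)

/-- If the asymptotic paths have full mass, the path measure lives on countably many of them. -/
lemma exists_countable_of_one_le_asymptoticMass (hW0 : ∀ x, 0 ≤ W x) (hW1 : S.ruelle W 1 = 1)
    {x : X} (h : 1 ≤ S.asymptoticMass W x) :
    ∃ D : Set (ℕ → PathNode X I), D.Countable ∧ D ⊆ S.asymptoticPaths W x ∧
      ∀ᵐ ω ∂(S.pathMeasure W hW0 hW1 x), ω ∈ D := by
  set D₀ := Function.support fun ω : S.asymptoticPaths W x => pathMass W ω.1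
  have hcount : D₀.Countable := Summable.countable_support_ennreal
    ((tsum_pathMass_le hW0 hW1 fun ω hω => hω.1).trans_lt (measure_lt_top _ _)).ne
  have hD : (Subtype.val '' D₀).Countable := hcount.image _
  have hsub : Subtype.val '' D₀ ⊆ S.asymptoticPaths W x := by
    rintro _ ⟨ω, -, rfl⟩
    exact ω.2
  refine ⟨_, hD, hsub, ?_⟩
  refine (mem_ae_iff_prob_eq_one hD.measurableSet).2 (le_antisymm prob_le_one (h.trans ?_))
  refine le_trans ?_ (tsum_pathMass_le hW0 hW1 fun ω hω => (hsub hω).1)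
  rw [tsum_image (pathMass W) Subtype.val_injective.injOn,
    tsum_subtype_eq_of_support_subset (f := fun ω : S.asymptoticPaths W x => pathMass W ω.1)
      (s := D₀) subset_rfl]
  exact le_rfl

/-- Along common multiples of the two lengths both limits coincide, and distinct `W`-cycles share no
point. -/
lemma disjoint_cycleSet (hW0 : ∀ x, 0 ≤ W x) (hW1 : S.ruelle W 1 = 1) {C D : Finset X}
    (hC : S.IsWCycle W C) (hD : S.IsWCycle W D) (hCD : C ≠ D) (x : X) :
    Disjoint (S.cycleSet C x) (S.cycleSet D x) := by
  rw [Set.disjoint_left]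
  rintro ω ⟨-, y, hy, hlim⟩ ⟨-, z, hz, hlim'⟩
  refine hCD (hC.eq_of_mem hW0 hW1 hD hy ?_)
  have h1 := hlim.comp (tendsto_id.atTop_mul_const' hD.1.1.card_pos)
  have h2 := hlim'.comp (tendsto_id.atTop_mul_const' hC.1.1.card_pos)
  have h3 : y = z := tendsto_nhds_unique h1 (h2.congr fun n => by
    simp only [Function.comp_apply, id]
    rw [Nat.mul_right_comm])
  rwa [h3]

end AsymptoticPaths

/-! ### Comparison of the asymptotic mass with a bump function, and the conclusion. -/

section Main

variable {X I : Type*} [MetricSpace X] [CompactSpace X] {S : BranchSystem X I} {W : X → ℝ}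

lemma one_le_asymptoticMass (hS : S.IsEndomorphismCase ∨ S.IsIFSCase)
    (hW0 : ∀ x, 0 ≤ W x) (hWlip : ∃ K, LipschitzWith K W) (hW1 : S.ruelle W 1 = 1)
    (hcont : ∀ f : X → ℝ, Continuous f → Continuous (S.ruelle W f)) (hTZ : S.TZ W)
    (hC : ∃ C, S.IsWCycle W C ∧ ∀ x, ((C : Set X) ∩ closure (S.backwardOrbit x)).Nonempty)
    (hrep : ∀ C, S.IsWCycle W C → S.IsRepelling C)
    (hcesaro : ∀ f : X → ℝ, (∃ K, LipschitzWith K f) → ∃ g : X → ℝ,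
      TendstoUniformly (fun (n : ℕ) x => (n : ℝ)⁻¹ * ∑ k ∈ Finset.range n, (S.ruelle W)^[k] f x)
        g atTop) (x : X) :
    1 ≤ S.asymptoticMass W x := by
  have hle : ∀ z, S.asymptoticMass W z ≤ 1 := fun z =>
    (tsum_pathMass_le hW0 hW1 fun ω hω => hω.1).trans prob_le_one
  have hne : ∀ z, S.asymptoticMass W z ≠ ⊤ := fun z => ((hle z).trans_lt ENNReal.one_lt_top).ne
  set φ : X → ℝ := fun z => (S.asymptoticMass W z).toReal with hφ
  have hsuper : S.ruelle W φ ≤ φ := fun z => by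
    have h := ENNReal.toReal_mono (hne z) (sum_mul_asymptoticMass_le (S := S) hW0 hW1 z)
    rw [ENNReal.toReal_sum fun i _ => ENNReal.mul_ne_top ENNReal.ofReal_ne_top (hne _)] at h
    simp only [ENNReal.toReal_mul, ENNReal.toReal_ofReal (hW0 _)] at h
    exact h
  have hiter : ∀ k, (S.ruelle W)^[k] φ ≤ φ := fun k => by
    induction k with
    | zero => exact le_rfl
    | succ k ih =>
      rw [Function.iterate_succ_apply']
      exact (ruelle_mono hW0 ih).trans hsuper
  suffices h : ∀ η > 0, 1 - η ≤ φ x by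
    have h1 : 1 ≤ φ x := le_of_forall_pos_le_add fun η hη => by linarith [h η hη]
    rwa [← ENNReal.ofReal_one, ENNReal.ofReal_le_iff_le_toReal (hne x)]
  intro η hη
  set P : Set X := {y | ∃ C, S.IsWCycle W C ∧ y ∈ C}
  have hP : P.Finite := finite_wCyclePoints hS hW0 hWlip hW1 hTZ hC hrep
  obtain ⟨δ, hδ, hnear⟩ := exists_uniform_radius (C := hP.toFinset)
    (P := fun y δ => ∀ z, dist z y < δ → 1 - η ≤ φ z)
    (fun y δ δ' hle h z hz => h z (hz.trans_le hle)) (fun y hy => by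
      obtain ⟨C, hC, hyC⟩ := hP.mem_toFinset.1 hy
      obtain ⟨δ, hδ, h⟩ := hC.exists_path_of_near hS hW0 hWlip hW1 hTZ (hrep C hC) hη
      refine ⟨δ, hδ, fun z hz => ?_⟩
      obtain ⟨ω, hω, hlim, hprod⟩ := h y hyC z hz
      have h1 : ENNReal.ofReal (1 - η) ≤ pathMass W ω := le_iInf fun N => by
        rw [← ENNReal.ofReal_prod_of_nonneg fun _ _ => hW0 _]
        exact ENNReal.ofReal_le_ofReal (hprod N)
      rw [← ENNReal.ofReal_le_iff_le_toReal (hne z)]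
      exact h1.trans (ENNReal.le_tsum (f := fun ω : S.asymptoticPaths W z => pathMass W ω.1)
        ⟨ω, hω, C, hC, y, hyC, hlim⟩))
  set f : X → ℝ := fun z => thickenedIndicator hδ P z
  have hf0 : 0 ≤ f := fun z => NNReal.coe_nonneg _
  have hf1 : f ≤ 1 := fun z => by exact_mod_cast thickenedIndicator_le_one hδ P z
  have hfP : ∀ C, S.IsWCycle W C → ∀ y ∈ C, f y = 1 := fun C hC y hy => by
    have := thickenedIndicator_one hδ P (x := y) ⟨C, hC, hy⟩
    simp only [f, this, NNReal.coe_one]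
  have hflip : ∃ K, LipschitzWith K f :=
    ⟨_, NNReal.isometry_coe.lipschitz.comp (lipschitzWith_thickenedIndicator hδ P)⟩
  have hfφ : (1 - η) • f ≤ φ := fun z => by
    by_cases hz : z ∈ Metric.thickening δ P
    · obtain ⟨y, hy, hzy⟩ := Metric.mem_thickening_iff.1 hz
      have h1 := hnear y (hP.mem_toFinset.2 hy) z hzy
      have h2 : 0 ≤ φ z := ENNReal.toReal_nonneg
      have h3 := hf0 z
      have h4 := hf1 z
      simp only [Pi.smul_apply, smul_eq_mul, Pi.zero_apply, Pi.one_apply] at *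
      nlinarith
    · have h1 : f z = 0 := by simp only [f, thickenedIndicator_zero hδ P hz, NNReal.coe_zero]
      simp only [Pi.smul_apply, h1, smul_zero]
      exact ENNReal.toReal_nonneg
  obtain ⟨a, ha, hlim⟩ := exists_tendsto_average hW0 hW1 hcont hTZ hC hcesaro hflip hf0 hf1 hfP x
  have hbound : ∀ k, (1 - η) * (S.ruelle W)^[k] f x ≤ φ x := fun k => by
    have h := iterate_ruelle_mono (S := S) hW0 hfφ k x
    rw [iterate_ruelle_smul] at h
    exact h.trans (hiter k x)
  have h1 : (1 - η) * a ≤ φ x := by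
    refine le_of_tendsto (hlim.const_mul (1 - η)) ?_
    filter_upwards [eventually_gt_atTop 0] with n hn
    have hn' : (0 : ℝ) < n := Nat.cast_pos.2 hn
    calc (1 - η) * ((n : ℝ)⁻¹ * ∑ k ∈ Finset.range n, (S.ruelle W)^[k] f x)
        = (n : ℝ)⁻¹ * ∑ k ∈ Finset.range n, (1 - η) * (S.ruelle W)^[k] f x := by
          rw [← Finset.mul_sum]
          ring
      _ ≤ (n : ℝ)⁻¹ * ∑ k ∈ Finset.range n, φ x := by
          gcongr with k
          exact hbound k
      _ = φ x := by simp [hn'.ne']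
  -- For `η > 1` the factor `1 - η` is negative and `1 ≤ a` does not help, but the bound is then
  -- trivial.
  rcases le_total η 1 with h | h
  · nlinarith
  · exact (sub_nonpos.2 h).trans ENNReal.toReal_nonneg

end Main

end BranchSystem

theorem theorem6 {X I : Type*} [MetricSpace X] [CompactSpace X] (S : BranchSystem X I)
    (hS : S.IsEndomorphismCase ∨ S.IsIFSCase)
    (W : X → ℝ) (hW0 : ∀ x, 0 ≤ W x) (hWlip : ∃ K, LipschitzWith K W)
    (hW1 : S.ruelle W 1 = 1)
    (hcont : ∀ f : X → ℝ, Continuous f → Continuous (S.ruelle W f))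
    (hTZ : S.TZ W)
    (hC : ∃ C, S.IsWCycle W C ∧ ∀ x, ((C : Set X) ∩ closure (S.backwardOrbit x)).Nonempty)
    (hrep : ∀ C, S.IsWCycle W C → S.IsRepelling C)
    (hcesaro : ∀ f : X → ℝ, (∃ K, LipschitzWith K f) → ∃ g : X → ℝ,
      TendstoUniformly (fun (n : ℕ) x => (n : ℝ)⁻¹ * ∑ k ∈ Finset.range n, (S.ruelle W)^[k] f x)
        g atTop) :
    (∀ x, ∀ᵐ ω ∂(S.pathMeasure W hW0 hW1 x), ∃ C, S.IsWCycle W C ∧ ω ∈ S.cycleSet C x) ∧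
    ∀ x, HasSum (fun C : {C : Finset X // S.IsWCycle W C} => S.cycleFun W hW0 hW1 C x) 1 := by
  have hsupp := fun x => BranchSystem.exists_countable_of_one_le_asymptoticMass hW0 hW1
    (BranchSystem.one_le_asymptoticMass hS hW0 hWlip hW1 hcont hTZ hC hrep hcesaro x)
  have hae : ∀ x, ∀ᵐ ω ∂(S.pathMeasure W hW0 hW1 x), ∃ C, S.IsWCycle W C ∧ ω ∈ S.cycleSet C x := by
    intro x
    obtain ⟨D, -, hD, hDae⟩ := hsupp x
    exact hDae.mono fun ω hω =>
      BranchSystem.exists_mem_cycleSet_of_mem_asymptoticPaths hW0 hW1 (hD hω)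
  refine ⟨hae, fun x => ?_⟩
  obtain ⟨D, hDc, -, hDae⟩ := hsupp x
  have hfin := BranchSystem.finite_wCyclePoints hS hW0 hWlip hW1 hTZ hC hrep
  have : Finite {C : Finset X // S.IsWCycle W C} :=
    Set.Finite.to_subtype (hfin.toFinset.powerset.finite_toSet.subset fun C hC =>
      Finset.mem_coe.2 (Finset.mem_powerset.2 fun y hy => hfin.mem_toFinset.2 ⟨C, hC, hy⟩))
  have hnull : ∀ C : {C : Finset X // S.IsWCycle W C},
      NullMeasurableSet (S.cycleSet C x) (S.pathMeasure W hW0 hW1 x) := fun C => by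
    -- Up to a null set, `cycleSet` is its intersection with the countable set `D`, which is
    -- measurable.
    refine (hDc.mono (Set.inter_subset_right (s := S.cycleSet C x))).measurableSet
      |>.nullMeasurableSet.congr ?_
    filter_upwards [hDae] with ω hω
    exact propext (and_iff_left hω)
  have hunion : ∑' C : {C : Finset X // S.IsWCycle W C},
      S.pathMeasure W hW0 hW1 x (S.cycleSet C x) = 1 := by
    rw [← measure_iUnion₀ (fun C D hCD => (BranchSystem.disjoint_cycleSet hW0 hW1 C.2 D.2
      (fun h => hCD (Subtype.ext h)) x).aedisjoint) hnull]
    refine le_antisymm prob_le_one ?_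
    rw [← measure_univ (μ := S.pathMeasure W hW0 hW1 x)]
    refine measure_mono_ae ?_
    filter_upwards [hae x] with ω ⟨C, hC, hω⟩ _
    exact Set.mem_iUnion.2 ⟨⟨C, hC⟩, hω⟩
  have h := ENNReal.hasSum_toReal (f := fun C : {C : Finset X // S.IsWCycle W C} =>
    S.pathMeasure W hW0 hW1 x (S.cycleSet C x)) (by rw [hunion]; exact ENNReal.one_ne_top)
  have h1 : ∑' C : {C : Finset X // S.IsWCycle W C},
      (S.pathMeasure W hW0 hW1 x (S.cycleSet C x)).toReal = 1 := by
    rw [← ENNReal.tsum_toReal_eq fun C => measure_ne_top _ _, hunion, ENNReal.toReal_one]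
  rw [h1] at h
  exact h
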